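/- **Definitions.** A *functorial path* on a category $\mathcal C$ is a functor $P:\mathcal C\to\mathcal C$ with natural transformations $\iota:1\to P$ and $\delta^0,\delta^1:P\to 1$ such that $\delta^0\iota=\delta^1\iota=1$. In this statement every path also carries the following natural transformations. * A symmetry $\tau:P\to P$ with $\tau\tau=1$, $\tau\iota=\iota$, $\delta^k\tau=\delta^{1-k}$. * A coproduct $c:P\to P^2$ such that $(P,\delta^1,c)$ is a comonad, $c_A\iota_A=\iota_{P(A)}\iota_A$ and $\delta^0_{P(A)}c_A=P(\delta^0_A)c_A=\iota_A\delta^0_A$. * An interchange, i.e. an automorphism $\mu$ of $P^2$ with $\delta^k_{P(A)}\mu_A=P(\delta^k_A)$ and $P(\delta^k_A)\mu_A=\delta^k_{P(A)}$. * A folding map $\nabla:P^2\to P$ with $\delta^k_A\nabla_A=\delta^k_A\delta^k_{P(A)}$ and $\nabla_A\iota_{P(A)}=1$. A *P-category* is a category with finite products and a final object $e$, with such a path and classes $\mathcal F$ (fibrations) and $\mathcal W$ (weak equivalences) such that: * (P1) $\mathcal F$ and $\mathcal W$ contain the isomorphisms and are closed under composition, $\mathcal W$ has the two out of three property, and every $A\to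 e$ is a fibration. * (P2) $\iota_A$ is a weak equivalence, $(\delta^0_A,\delta^1_A):P(A)\to A\times A$ is a fibration, and $\delta^0_A,\delta^1_A$ are trivial fibrations (both fibrations and weak equivalences). * (P3) For $u:A\to C$ and a fibration $v:B\to C$, the fibre product $A\times_CB$ exists, $A\times_CB\to A$ is a fibration, it is a trivial fibration if $v$ is one, and $A\times_CB\to B$ is a weak equivalence if $u$ is one. * (P4) $P$ preserves fibrations, weak equivalences and the fibre products of (P3). * (P5) For every fibration $v:A\to B$, the map $P(A)\to (A\times A)\times_{B\times B}P(B)$ induced by $(\delta^0_A,\delta^1_A)$ and $P(v)$ is a fibration. An object $X$ is *cofibrant* if every map from $X$ to the target of a trivial fibration lifts along it. There are *enough cofibrant models* if every object receives a weak equivalence from a cofibrant object. **Setting.** Let $I$ be a finite category with a function $|\cdot|:\mathrm{Ob}(I)\to\{0,1\}$ such that $|i|<|j|$ for every non-identity morphism $i\to j$. Let $i\mapsto\mathcal C_i$, $u\mapsto u_*$ be a functor from $I$ to categories. Let each $\mathcal C_i$ be a P-category, and let each $u_*:\mathcal C_i\to\mathcal C_j$ preserve the path objects with all their structure maps (up to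 a specified natural isomorphism $u_*P\cong Pu_*$), fibrations, weak equivalences, fibre products along fibrations, and cofibrant objects. Let $\Gamma\mathcal C$ be the category of diagrams $A=(A_i,\ \varphi_u:u_*A_i\to A_j)$, where $u:i\to j$ runs over the non-identity morphisms of $I$ (for identities the comparison morphism is the identity). A morphism of diagrams is a family of morphisms $f_i:A_i\to B_i$ compatible with the comparison morphisms. Let $\mathcal W$ be the class of level-wise weak equivalences, $\mathrm{Ho}(\Gamma\mathcal C)=\Gamma\mathcal C[\mathcal W^{-1}]$, and $\Gamma\mathcal C_{cof}$ the full subcategory of the diagrams all of whose $A_i$ are cofibrant in $\mathcal C_i$. The level-wise path of a diagram $B$ is $P(B)=(P(B_i))$ with comparison morphisms $u_*P(B_i)\cong P(u_*B_i)\xrightarrow{P(\varphi_u)}P(B_j)$. A *ho-morphism* $f:A\rightsquigarrow B$ is a pair of families $f_i:A_i\to B_i$ and $F_u:u_*A_i\to P(B_j)$ (for $u:i\to j$ non-identity) with $\delta^0F_u=f_j\varphi_u$ and $\delta^1F_u=\varphi_u\,u_*(f_i)$. A morphism is a ho-morphism with constant homotopies $F_u=\iota f_j\varphi_u$. A ho-morphism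 composes with morphisms $g$ and $h$ by $fg=(f_ig_i,\,F_u\,u_*(g_i))$ and $hf=(h_if_i,\,P(h_j)F_u)$. Ho-morphisms $f,g:A\rightsquigarrow B$ are *homotopic* if there is $h:A\rightsquigarrow P(B)$ with $\delta^0_Bh=f$ and $\delta^1_Bh=g$. Let $[A,B]^h$ be the set of ho-morphisms modulo the equivalence relation generated by homotopy. A morphism $f:A\to B$ is a *ho-equivalence* if there is $g:B\rightsquigarrow A$ such that $gf$ and $fg$ are connected to the identities by chains of homotopies. Let $\mathcal H$ be the closure of the class of ho-equivalences under composition. A *composite* of $f:A\rightsquigarrow B$ and $g:B\rightsquigarrow X$ is a ho-morphism $(g_if_i,\nabla_{X_j}L_u)$ where $L_u:u_*A_i\to P^2(X_j)$ satisfies $\delta^0_{P(X_j)}L_u=P(g_j)F_u$ and $P(\delta^1_{X_j})L_u=G_u\,u_*(f_i)$. For $f:A\rightsquigarrow B$, the *mapping path* $\mathcal P^h(f)$ is the diagram of the fibre products $\mathcal P(f_i)=A_i\times_{B_i}P(B_i)$ (of $f_i$ and $\delta^0$) with comparison morphisms $(\varphi_u,F_u)\circ u_*(\pi_1)$. Let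 $p_f=(\pi_1):\mathcal P^h(f)\to A$ and $q_f=(\delta^{|i|}_{B_i}\pi_2):\mathcal P^h(f)\to B$, which are morphisms of $\Gamma\mathcal C$. For classes $\mathcal S,\mathcal W$ of morphisms of a category $\mathcal D$ that contain the isomorphisms and are closed under composition, such that $\mathcal S$ becomes invertible in $\mathcal D[\mathcal W^{-1}]$, an object $M$ is *Cartan–Eilenberg cofibrant* if every $w:A\to B$ in $\mathcal W$ induces a bijection $\mathcal D[\mathcal S^{-1}](M,A)\to\mathcal D[\mathcal S^{-1}](M,B)$. A *left model* of $X$ is an object $M$ with a morphism $M\to X$ of $\mathcal D[\mathcal S^{-1}]$ that becomes an isomorphism in $\mathcal D[\mathcal W^{-1}]$. The triple $(\mathcal D,\mathcal S,\mathcal W)$ is a *left Cartan–Eilenberg category* if every object has a Cartan–Eilenberg cofibrant left model. A full subcategory is a *subcategory of cofibrant models* if its objects are Cartan–Eilenberg cofibrant and every object of $\mathcal D$ has a left model in it. **Theorem.** In this setting, assume that every $\mathcal C_i$ has enough cofibrant models. Then $(\Gamma\mathcal C,\mathcal H,\mathcal W)$ is a left Cartan–Eilenberg category and $\Gamma\mathcal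 C_{cof}$ is a full subcategory of cofibrant models. The objects of $\Gamma\mathcal C_{cof}$ with the sets $[A,B]^h$ form a category $\pi^h\Gamma\mathcal C_{cof}$, in which composites of representatives exist, the composition sends the classes of $f$ and $g$ to the class of any composite of $f$ and $g$, and the identities are the classes of the identity morphisms. The inclusion induces an equivalence of categories $$\pi^h\Gamma\mathcal C_{cof}\xrightarrow{\ \sim\ }\mathrm{Ho}(\Gamma\mathcal C),$$ which, up to isomorphism, sends $A$ to $A$, the class of a morphism of $\Gamma\mathcal C$ to its image in $\mathrm{Ho}(\Gamma\mathcal C)$, and the class of a ho-morphism $f$ to $q_f\circ p_f^{-1}$. -/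

import Mathlib

open CategoryTheory CategoryTheory.Limits

universe w v u

namespace CEDiagram

/-! ### Categories with a functorial path -/

/-- A functorial path `P` on a category, i.e. an endofunctor with natural transformations
`ι : 1 ⟶ P` and `δ 0, δ 1 : P ⟶ 1` such that `δ k ∘ ι = 1`, together with a symmetry, a coproduct,
an interchange and a folding map.  For an object `A`, the map `δ k` of the object `P A` is
`(δ k).app (P.obj A)`, and `P` applied to `δ k` of `A` is `P.map ((δ k).app A)`; both are maps
`P (P A) ⟶ P A`. -/
structure FunctorialPath (C : Type u) [Category.{v} C] where
  P : C ⥤ C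
  ι : 𝟭 C ⟶ P
  δ : Fin 2 → (P ⟶ 𝟭 C)
  ι_δ : ∀ (k : Fin 2) (A : C), ι.app A ≫ (δ k).app A = 𝟙 A
  /-- the symmetry -/
  symm : P ⟶ P
  symm_symm : ∀ A : C, symm.app A ≫ symm.app A = 𝟙 (P.obj A)
  ι_symm : ∀ A : C, ι.app A ≫ symm.app A = ι.app A
  symm_δ : ∀ (k : Fin 2) (A : C), symm.app A ≫ (δ k).app A = (δ (1 - k)).app A
  /-- the coproduct -/
  coprod : P ⟶ P ⋙ P
  coprod_coassoc : ∀ A : C,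
    coprod.app A ≫ coprod.app (P.obj A) = coprod.app A ≫ P.map (coprod.app A)
  coprod_δ_one : ∀ A : C, coprod.app A ≫ (δ 1).app (P.obj A) = 𝟙 (P.obj A)
  coprod_map_δ_one : ∀ A : C, coprod.app A ≫ P.map ((δ 1).app A) = 𝟙 (P.obj A)
  ι_coprod : ∀ A : C, ι.app A ≫ coprod.app A = ι.app A ≫ ι.app (P.obj A)
  coprod_δ_zero : ∀ A : C, coprod.app A ≫ (δ 0).app (P.obj A) = (δ 0).app A ≫ ι.app A
  coprod_map_δ_zero : ∀ A : C, coprod.app A ≫ P.map ((δ 0).app A) = (δ 0).app A ≫ ι.app A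
  /-- the interchange -/
  interchange : P ⋙ P ≅ P ⋙ P
  interchange_δ : ∀ (k : Fin 2) (A : C),
    interchange.hom.app A ≫ (δ k).app (P.obj A) = P.map ((δ k).app A)
  interchange_map_δ : ∀ (k : Fin 2) (A : C),
    interchange.hom.app A ≫ P.map ((δ k).app A) = (δ k).app (P.obj A)
  /-- the folding map -/
  fold : P ⋙ P ⟶ P
  fold_δ : ∀ (k : Fin 2) (A : C),
    fold.app A ≫ (δ k).app A = (δ k).app (P.obj A) ≫ (δ k).app A
  ι_fold : ∀ A : C, ι.app (P.obj A) ≫ fold.app A = 𝟙 (P.obj A)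

/-- A P-category structure on a category: finite products, a functorial path (with symmetry,
coproduct, interchange and folding map), and classes `fib` of fibrations and `weq` of weak
equivalences subject to the five axioms of a P-category. -/
structure PCategory (C : Type u) [Category.{v} C] extends FunctorialPath C where
  hasFiniteProducts : HasFiniteProducts C
  fib : MorphismProperty C
  weq : MorphismProperty C
  -- first axiom
  fib_of_isIso : ∀ {A B : C} (f : A ⟶ B), IsIso f → fib f
  fib_comp : ∀ {A B X : C} (f : A ⟶ B) (g : B ⟶ X), fib f → fib g → fib (f ≫ g)
  weq_of_isIso : ∀ {A B : C} (f : A ⟶ B), IsIso f → weq f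
  weq_comp_and_two_of_three : weq.HasTwoOutOfThreeProperty
  fib_terminal : ∀ A : C, fib (terminal.from A)
  -- second axiom
  weq_ι : ∀ A : C, weq (ι.app A)
  fib_δ_δ : ∀ A : C, fib (prod.lift ((δ 0).app A) ((δ 1).app A))
  fib_δ : ∀ (k : Fin 2) (A : C), fib ((δ k).app A)
  weq_δ : ∀ (k : Fin 2) (A : C), weq ((δ k).app A)
  -- third axiom
  hasPullback : ∀ {A B X : C} (f : A ⟶ X) (g : B ⟶ X), fib g → HasPullback f g
  fib_pullback : ∀ {Y A B X : C} {p : Y ⟶ A} {q : Y ⟶ B} {f : A ⟶ X} {g : B ⟶ X},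
    IsPullback p q f g → fib g → fib p
  weq_pullback : ∀ {Y A B X : C} {p : Y ⟶ A} {q : Y ⟶ B} {f : A ⟶ X} {g : B ⟶ X},
    IsPullback p q f g → fib g → weq g → weq p
  weq_pullback' : ∀ {Y A B X : C} {p : Y ⟶ A} {q : Y ⟶ B} {f : A ⟶ X} {g : B ⟶ X},
    IsPullback p q f g → fib g → weq f → weq q
  -- fourth axiom
  fib_map : ∀ {A B : C} (f : A ⟶ B), fib f → fib (P.map f)
  weq_map : ∀ {A B : C} (f : A ⟶ B), weq f → weq (P.map f)
  isPullback_map : ∀ {Y A B X : C} {p : Y ⟶ A} {q : Y ⟶ B} {f : A ⟶ X} {g : B ⟶ X},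
    IsPullback p q f g → fib g → IsPullback (P.map p) (P.map q) (P.map f) (P.map g)
  -- fifth axiom; `Y` is the double mapping path of `g` with itself
  fib_double : ∀ {A B Y : C} (g : A ⟶ B) (p : Y ⟶ A ⨯ A) (q : Y ⟶ P.obj B)
    (l : P.obj A ⟶ Y), fib g →
    IsPullback p q (prod.map g g) (prod.lift ((δ 0).app B) ((δ 1).app B)) →
    l ≫ p = prod.lift ((δ 0).app A) ((δ 1).app A) → l ≫ q = P.map g → fib l

/-- Cofibrant objects: every map to the target of a trivial fibration lifts along it. -/
def PCategory.Cofibrant {C : Type u} [Category.{v} C] (K : PCategory C) (X : C) : Prop :=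
  ∀ ⦃A B : C⦄ (p : A ⟶ B) (f : X ⟶ B), K.fib p → K.weq p → ∃ g : X ⟶ A, g ≫ p = f

/-- Every object admits a weak equivalence from a cofibrant object. -/
def PCategory.EnoughCofibrant {C : Type u} [Category.{v} C] (K : PCategory C) : Prop :=
  ∀ A : C, ∃ (M : C) (f : M ⟶ A), K.Cofibrant M ∧ K.weq f

/-- Compatibility of a functor with P-category structures: it preserves path objects (up to a
specified natural isomorphism `θ` compatible with all the structure maps of the functorial paths),
fibrations, weak equivalences and fibre products along fibrations. -/
structure PFunctor {C D : Type u} [Category.{v} C] [Category.{v} D]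
    (K : PCategory C) (L : PCategory D) (T : C ⥤ D) where
  θ : K.P ⋙ T ≅ T ⋙ L.P
  θ_ι : ∀ A : C, T.map (K.ι.app A) ≫ θ.hom.app A = L.ι.app (T.obj A)
  θ_δ : ∀ (k : Fin 2) (A : C), θ.hom.app A ≫ (L.δ k).app (T.obj A) = T.map ((K.δ k).app A)
  θ_symm : ∀ A : C,
    T.map (K.symm.app A) ≫ θ.hom.app A = θ.hom.app A ≫ L.symm.app (T.obj A)
  θ_coprod : ∀ A : C,
    T.map (K.coprod.app A) ≫ θ.hom.app (K.P.obj A) ≫ L.P.map (θ.hom.app A) =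
      θ.hom.app A ≫ L.coprod.app (T.obj A)
  θ_interchange : ∀ A : C,
    T.map (K.interchange.hom.app A) ≫ θ.hom.app (K.P.obj A) ≫ L.P.map (θ.hom.app A) =
      (θ.hom.app (K.P.obj A) ≫ L.P.map (θ.hom.app A)) ≫ L.interchange.hom.app (T.obj A)
  θ_fold : ∀ A : C,
    T.map (K.fold.app A) ≫ θ.hom.app A =
      (θ.hom.app (K.P.obj A) ≫ L.P.map (θ.hom.app A)) ≫ L.fold.app (T.obj A)
  fib_map : ∀ {A B : C} (f : A ⟶ B), K.fib f → L.fib (T.map f)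
  weq_map : ∀ {A B : C} (f : A ⟶ B), K.weq f → L.weq (T.map f)
  isPullback_map : ∀ {Y A B X : C} {p : Y ⟶ A} {q : Y ⟶ B} {f : A ⟶ X} {g : B ⟶ X},
    IsPullback p q f g → K.fib g → IsPullback (T.map p) (T.map q) (T.map f) (T.map g)

/-! ### Cartan-Eilenberg categories -/

section CartanEilenberg

variable {C : Type u} [Category.{v} C]

/-- `(C, S, W)` is a category with strong and weak equivalences: both classes contain the
isomorphisms and are closed under composition, and `S` lies in the saturation of `W`, the class of
the morphisms that become invertible in `C[W⁻¹]`. -/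
structure IsStrongWeak (S W : MorphismProperty C) : Prop where
  strong_of_isIso : ∀ {A B : C} (f : A ⟶ B), IsIso f → S f
  strong_comp : ∀ {A B X : C} (f : A ⟶ B) (g : B ⟶ X), S f → S g → S (f ≫ g)
  weak_of_isIso : ∀ {A B : C} (f : A ⟶ B), IsIso f → W f
  weak_comp : ∀ {A B X : C} (f : A ⟶ B) (g : B ⟶ X), W f → W g → W (f ≫ g)
  strong_le : S.IsInvertedBy W.Q

/-- `M` is Cartan-Eilenberg cofibrant in `(C, S, W)`: every weak equivalence `f : A ⟶ B` induces
a bijection `C[S⁻¹](M, A) → C[S⁻¹](M, B)`. -/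
def IsCECofibrant (S W : MorphismProperty C) (M : C) : Prop :=
  ∀ ⦃A B : C⦄ (f : A ⟶ B), W f →
    Function.Bijective (fun g : S.Q.obj M ⟶ S.Q.obj A => g ≫ S.Q.map f)

/-- `M` is a left model of `X`: there is a morphism `M ⟶ X` of `C[S⁻¹]` that becomes an
isomorphism under the canonical functor `C[S⁻¹] ⥤ C[W⁻¹]`. -/
def IsLeftModel {S W : MorphismProperty C} (h : IsStrongWeak S W) (M X : C) : Prop :=
  ∃ ε : S.Q.obj M ⟶ S.Q.obj X, IsIso ((Localization.Construction.lift W.Q h.strong_le).map ε)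

/-- `(C, S, W)` is a left Cartan-Eilenberg category: a category with strong and weak equivalences
in which every object has a Cartan-Eilenberg cofibrant left model. -/
def IsLeftCartanEilenberg (S W : MorphismProperty C) : Prop :=
  ∃ h : IsStrongWeak S W, ∀ X : C, ∃ M : C, IsCECofibrant S W M ∧ IsLeftModel h M X

/-- The full subcategory of the objects with property `Q` is a subcategory of cofibrant models of
`(C, S, W)`: its objects are Cartan-Eilenberg cofibrant, and every object of `C` has a left model
in it. -/
def IsSubcategoryOfCofibrantModels (S W : MorphismProperty C) (Q : ObjectProperty C) : Prop :=
  ∃ h : IsStrongWeak S W, (∀ M : C, Q M → IsCECofibrant S W M) ∧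
    ∀ X : C, ∃ M : C, Q M ∧ IsLeftModel h M X

end CartanEilenberg

/-! ### Diagram categories -/

/-- A morphism of a category that is not an identity. -/
def NonIdentity {I : Type w} [SmallCategory I] {i j : I} (a : i ⟶ j) : Prop :=
  ∀ h : i = j, a ≠ eqToHom h

/-- The data for a category of diagrams: an index category with a degree function with values in
`{0, 1}` that is strictly increasing along non-identity morphisms, a functor `F` from the index
category to categories, P-category structures on the vertex categories `F.obj i`, and the
compatibility of the transition functors with them. -/
structure DiagramData (I : Type w) [SmallCategory I] where
  deg : I → Fin 2
  deg_lt : ∀ {i j : I} (a : i ⟶ j), NonIdentity a → deg i < deg j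
  F : I ⥤ Cat.{v, u}
  K : ∀ i : I, PCategory (F.obj i)
  T : ∀ {i j : I} (a : i ⟶ j), PFunctor (K i) (K j) (F.map a).toFunctor

variable {I : Type w} [SmallCategory I]

namespace DiagramData

/-- The transition functor of a morphism of the index category. -/
abbrev push (D : DiagramData.{w, v, u} I) {i j : I} (a : i ⟶ j) : D.F.obj i ⥤ D.F.obj j :=
  (D.F.map a).toFunctor

end DiagramData

/-- A diagram, that is, a section of the projection of the Grothendieck construction of `F` to the
index category: objects `A i` of `F.obj i` with comparison morphisms `a_* (A i) ⟶ A j`.  The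
comparison morphism of an identity is an identity, so only those of the non-identity morphisms are
recorded; two non-identity morphisms are never composable because of the degree function, so there
is no further functoriality condition. -/
structure Diagram (D : DiagramData.{w, v, u} I) where
  obj : ∀ i : I, D.F.obj i
  φ : ∀ {i j : I} (a : i ⟶ j), NonIdentity a → ((D.push a).obj (obj i) ⟶ obj j)

namespace Diagram

variable {D : DiagramData.{w, v, u} I}

/-- A morphism of diagrams. -/
@[ext]
structure Hom (A B : Diagram D) where
  app : ∀ i : I, A.obj i ⟶ B.obj i
  comm : ∀ {i j : I} (a : i ⟶ j) (ha : NonIdentity a),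
    (D.push a).map (app i) ≫ B.φ a ha = A.φ a ha ≫ app j

/-- The category of diagrams. -/
instance : Category (Diagram D) where
  Hom := Hom
  id A := ⟨fun i => 𝟙 (A.obj i), fun a ha => by simp⟩
  comp f g := ⟨fun i => f.app i ≫ g.app i, fun a ha => by
    rw [Functor.map_comp, Category.assoc, g.comm, ← Category.assoc, f.comm, Category.assoc]⟩
  id_comp f := Hom.ext (funext fun i => Category.id_comp _)
  comp_id f := Hom.ext (funext fun i => Category.comp_id _)
  assoc f g h := Hom.ext (funext fun i => Category.assoc _ _ _)

/-- The level-wise weak equivalences. -/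
def weq (D : DiagramData.{w, v, u} I) : MorphismProperty (Diagram D) :=
  fun _ _ f => ∀ i : I, (D.K i).weq (f.app i)

/-- The level-wise cofibrant diagrams. -/
def cof (D : DiagramData.{w, v, u} I) : ObjectProperty (Diagram D) :=
  fun A => ∀ i : I, (D.K i).Cofibrant (A.obj i)

/-- The level-wise path object of a diagram. -/
def path (B : Diagram D) : Diagram D where
  obj i := (D.K i).P.obj (B.obj i)
  φ {i j} a ha := (D.T a).θ.hom.app (B.obj i) ≫ (D.K j).P.map (B.φ a ha)

/-- The morphisms of diagrams `δ k : P(B) ⟶ B`. -/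
def pathδ (k : Fin 2) (B : Diagram D) : B.path ⟶ B where
  app i := ((D.K i).δ k).app (B.obj i)
  comm {i j} a ha := by
    have h := ((D.K j).δ k).naturality (B.φ a ha)
    have h' := (D.T a).θ_δ k (B.obj i)
    simp only [Functor.id_map, Functor.id_obj] at h
    change (D.push a).map (((D.K i).δ k).app (B.obj i)) ≫ B.φ a ha =
      ((D.T a).θ.hom.app (B.obj i) ≫ (D.K j).P.map (B.φ a ha)) ≫ ((D.K j).δ k).app (B.obj j)
    rw [Category.assoc, h, ← h', Category.assoc]

end Diagram

/-- A ho-morphism of diagrams: level-wise morphisms together with, for every (non-identity)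
morphism of the index category, a homotopy that makes the square of the comparison morphisms
commute. -/
@[ext]
structure HoHom {D : DiagramData.{w, v, u} I} (A B : Diagram D) where
  app : ∀ i : I, A.obj i ⟶ B.obj i
  htpy : ∀ {i j : I} (a : i ⟶ j), NonIdentity a →
    ((D.push a).obj (A.obj i) ⟶ (D.K j).P.obj (B.obj j))
  htpy_zero : ∀ {i j : I} (a : i ⟶ j) (ha : NonIdentity a),
    htpy a ha ≫ ((D.K j).δ 0).app (B.obj j) = A.φ a ha ≫ app j
  htpy_one : ∀ {i j : I} (a : i ⟶ j) (ha : NonIdentity a),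
    htpy a ha ≫ ((D.K j).δ 1).app (B.obj j) = (D.push a).map (app i) ≫ B.φ a ha

namespace HoHom

variable {D : DiagramData.{w, v, u} I} {A B X : Diagram D}

/-- A morphism of diagrams as a ho-morphism, with constant homotopies. -/
def ofHom (f : A ⟶ B) : HoHom A B where
  app := f.app
  htpy {i j} a ha := (A.φ a ha ≫ f.app j) ≫ (D.K j).ι.app (B.obj j)
  htpy_zero {i j} a ha := by
    rw [Category.assoc, (D.K j).ι_δ]; exact Category.comp_id _
  htpy_one {i j} a ha := by
    rw [Category.assoc, (D.K j).ι_δ, f.comm]; exact Category.comp_id _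

/-- A ho-morphism followed by a morphism. -/
def comp (f : HoHom A B) (g : B ⟶ X) : HoHom A X where
  app i := f.app i ≫ g.app i
  htpy {i j} a ha := f.htpy a ha ≫ (D.K j).P.map (g.app j)
  htpy_zero {i j} a ha := by
    have h := ((D.K j).δ 0).naturality (g.app j)
    simp only [Functor.id_map, Functor.id_obj] at h
    rw [Category.assoc, h, ← Category.assoc, f.htpy_zero, Category.assoc]
  htpy_one {i j} a ha := by
    have h := ((D.K j).δ 1).naturality (g.app j)
    simp only [Functor.id_map, Functor.id_obj] at h
    rw [Category.assoc, h, ← Category.assoc, f.htpy_one, Functor.map_comp, Category.assoc,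
      Category.assoc, g.comm]

/-- A ho-morphism preceded by a morphism. -/
def precomp (g : A ⟶ B) (f : HoHom B X) : HoHom A X where
  app i := g.app i ≫ f.app i
  htpy {i j} a ha := (D.push a).map (g.app i) ≫ f.htpy a ha
  htpy_zero {i j} a ha := by
    rw [Category.assoc, f.htpy_zero, ← Category.assoc, g.comm, Category.assoc]
  htpy_one {i j} a ha := by
    rw [Category.assoc, f.htpy_one, Functor.map_comp, Category.assoc]

/-- `f` and `g` are homotopic: there is a ho-morphism `h : A ⇝ P(B)` with `δ 0 ∘ h = f` and
`δ 1 ∘ h = g`. -/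
def Homotopic (f g : HoHom A B) : Prop :=
  ∃ h : HoHom A B.path, h.comp (B.pathδ 0) = f ∧ h.comp (B.pathδ 1) = g

/-- The ho-morphism `k` is a composite of the ho-morphisms `f : A ⇝ B` and `g : B ⇝ X`: it is given
level-wise by the composite of `f` and `g`, and its homotopies are obtained with the folding map
from a filler `l : A i ⟶ P (P (X j))` of the two successive homotopies `P(g j) ∘ F_a` and
`G_a ∘ f i`. -/
def IsComposite (f : HoHom A B) (g : HoHom B X) (k : HoHom A X) : Prop :=
  (∀ i : I, k.app i = f.app i ≫ g.app i) ∧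
  ∀ {i j : I} (a : i ⟶ j) (ha : NonIdentity a),
    ∃ l : (D.push a).obj (A.obj i) ⟶ (D.K j).P.obj ((D.K j).P.obj (X.obj j)),
      l ≫ ((D.K j).δ 0).app ((D.K j).P.obj (X.obj j)) =
          f.htpy a ha ≫ (D.K j).P.map (g.app j) ∧
      l ≫ (D.K j).P.map (((D.K j).δ 1).app (X.obj j)) =
          (D.push a).map (f.app i) ≫ g.htpy a ha ∧
      k.htpy a ha = l ≫ (D.K j).fold.app (X.obj j)

/-! #### The mapping path of a ho-morphism -/

instance hasPullback_δ (f : HoHom A B) (i : I) :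
    HasPullback (f.app i) (((D.K i).δ 0).app (B.obj i)) :=
  (D.K i).hasPullback _ _ ((D.K i).fib_δ 0 _)

/-- The mapping path of a ho-morphism `f : A ⇝ B`: level-wise it is the fibre product of `f i` and
`δ 0 : P (B i) ⟶ B i`, and the comparison morphism of `a : i ⟶ j` is `(φ_a, F_a)` after the
first projection. -/
noncomputable def mappingPath (f : HoHom A B) : Diagram D where
  obj i := pullback (f.app i) (((D.K i).δ 0).app (B.obj i))
  φ {i j} a ha := (D.push a).map (pullback.fst (f.app i) (((D.K i).δ 0).app (B.obj i))) ≫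
    pullback.lift (A.φ a ha) (f.htpy a ha) (f.htpy_zero a ha).symm

/-- The morphism from the mapping path of `f : A ⇝ B` to `A`. -/
noncomputable def mappingPathFst (f : HoHom A B) : f.mappingPath ⟶ A where
  app i := pullback.fst (f.app i) (((D.K i).δ 0).app (B.obj i))
  comm {i j} a ha := by
    simp only [mappingPath, Category.assoc]
    rw [pullback.lift_fst]

/-- The morphism from the mapping path of `f : A ⇝ B` to `B`; at a vertex of degree `k` it is
`δ k` after the second projection. -/
noncomputable def mappingPathSnd (f : HoHom A B) : f.mappingPath ⟶ B where
  app i := pullback.snd (f.app i) (((D.K i).δ 0).app (B.obj i)) ≫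
    ((D.K i).δ (D.deg i)).app (B.obj i)
  comm {i j} a ha := by
    have hij := D.deg_lt a ha
    have hi : D.deg i = 0 := by omega
    have hj : D.deg j = 1 := by omega
    have h1 := f.htpy_one a ha
    have h2 : pullback.snd (f.app i) (((D.K i).δ 0).app (B.obj i)) ≫
        ((D.K i).δ 0).app (B.obj i) =
        pullback.fst (f.app i) (((D.K i).δ 0).app (B.obj i)) ≫ f.app i :=
      pullback.condition.symm
    simp only [mappingPath, Category.assoc]
    rw [hi, hj, h2, ← Category.assoc (pullback.lift _ _ _), pullback.lift_snd, h1,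
      Functor.map_comp, Category.assoc]

end HoHom

/-- A morphism `f : A ⟶ B` of diagrams is a ho-equivalence if there is a ho-morphism `g : B ⇝ A`
such that `g f` and `f g` are connected to the identities by chains of homotopies. -/
def isHoEquiv (D : DiagramData.{w, v, u} I) : MorphismProperty (Diagram D) :=
  fun A B f => ∃ g : HoHom B A,
    Relation.EqvGen HoHom.Homotopic (g.precomp f) (HoHom.ofHom (𝟙 A)) ∧
    Relation.EqvGen HoHom.Homotopic (g.comp f) (HoHom.ofHom (𝟙 B))

/-- The closure of the class of ho-equivalences under composition. -/
def hoEquiv (D : DiagramData.{w, v, u} I) : MorphismProperty (Diagram D) :=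
  (isHoEquiv D).multiplicativeClosure

/-- Ho-morphisms modulo the equivalence relation generated by homotopy. -/
def HoClass {D : DiagramData.{w, v, u} I} (A B : Diagram D) :=
  Quot (HoHom.Homotopic (A := A) (B := B))

/-- The class of a ho-morphism. -/
def HoHom.cls {D : DiagramData.{w, v, u} I} {A B : Diagram D} (f : HoHom A B) : HoClass A B :=
  Quot.mk _ f

/-- The structure of a category on the level-wise cofibrant diagrams with homotopy classes of
ho-morphisms, where the composition is that of ho-morphisms: composites of representatives exist,
and the composition sends the classes of `f` and `g` to the class of any composite of `f` and `g`
(so there is at most one such structure). -/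
structure HoCategory (D : DiagramData.{w, v, u} I) where
  comp : ∀ {A B X : (Diagram.cof D).FullSubcategory},
    HoClass A.obj B.obj → HoClass B.obj X.obj → HoClass A.obj X.obj
  exists_composite : ∀ {A B X : (Diagram.cof D).FullSubcategory}
    (f : HoHom A.obj B.obj) (g : HoHom B.obj X.obj), ∃ k : HoHom A.obj X.obj, f.IsComposite g k
  comp_cls : ∀ {A B X : (Diagram.cof D).FullSubcategory}
    (f : HoHom A.obj B.obj) (g : HoHom B.obj X.obj) (k : HoHom A.obj X.obj),
    f.IsComposite g k → comp f.cls g.cls = k.cls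
  id_comp : ∀ {A B : (Diagram.cof D).FullSubcategory} (f : HoClass A.obj B.obj),
    comp (HoHom.ofHom (𝟙 A.obj)).cls f = f
  comp_id : ∀ {A B : (Diagram.cof D).FullSubcategory} (f : HoClass A.obj B.obj),
    comp f (HoHom.ofHom (𝟙 B.obj)).cls = f
  assoc : ∀ {A B X Y : (Diagram.cof D).FullSubcategory} (f : HoClass A.obj B.obj)
    (g : HoClass B.obj X.obj) (h : HoClass X.obj Y.obj), comp (comp f g) h = comp f (comp g h)

/-- The objects of the category of level-wise cofibrant diagrams and homotopy classes of
ho-morphisms. -/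
structure HoCategory.Ob {D : DiagramData.{w, v, u} I} (H : HoCategory D) where
  diag : Diagram D
  isCof : Diagram.cof D diag

namespace HoCategory

variable {D : DiagramData.{w, v, u} I} (H : HoCategory D)

instance : Category H.Ob where
  Hom A B := HoClass A.diag B.diag
  id A := (HoHom.ofHom (𝟙 A.diag)).cls
  comp {A B X} f g := H.comp (A := ⟨A.diag, A.isCof⟩) (B := ⟨B.diag, B.isCof⟩)
    (X := ⟨X.diag, X.isCof⟩) f g
  id_comp {A B} f := H.id_comp (A := ⟨A.diag, A.isCof⟩) (B := ⟨B.diag, B.isCof⟩) f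
  comp_id {A B} f := H.comp_id (A := ⟨A.diag, A.isCof⟩) (B := ⟨B.diag, B.isCof⟩) f
  assoc {A B X Y} f g h := H.assoc (A := ⟨A.diag, A.isCof⟩) (B := ⟨B.diag, B.isCof⟩)
    (X := ⟨X.diag, X.isCof⟩) (Y := ⟨Y.diag, Y.isCof⟩) f g h

/-- The morphism given by the class of a ho-morphism. -/
def homCls {A B : H.Ob} (f : HoHom A.diag B.diag) : A ⟶ B := f.cls

end HoCategory

end CEDiagram

/-! A ho-morphism `f` is studied through the roof `p_f`, `q_f` of strict morphisms out of its
mapping path. The projection `p_f` has a ho-section `s` (`toMappingPath`) with `p_f s = 1` and `q_f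
s = f` on the nose and `s p_f` homotopic to `1`. Hence `p_f` is a ho-equivalence, and every functor
on diagrams that inverts the maps `p_f` and the constant paths turns `f` into `q_f p_f⁻¹`, a
morphism that depends only on the class of `f` (`HoHom.roof`). Such a functor also inverts all
ho-equivalences.

Let `M` be level-wise cofibrant. Postcomposition with strict morphisms makes `[M, -]^h` a functor,
and no composition of ho-morphisms is needed for this. Along a trivial fibration, paths and squares
with prescribed boundary lift, by the fifth axiom and the cofibrancy of the `M i` and of their
transition images. So `[M, -]^h` sends level-wise trivial fibrations to bijections, and by Brown's
factorization all weak equivalences (`IsCofibrant.bijective_map`). It therefore extends to the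
localizations at `weq` and at `hoEquiv`. A Yoneda argument, using `1 = p_f s` and `f = q_f s`, shows
that the class of the identity represents it in both (`HoClass.bijective_roof`). The localization at
`hoEquiv` gives Cartan-Eilenberg cofibrancy of `M`, the one at `weq` gives full faithfulness.

Models are chosen vertex by vertex; the comparison morphisms lift up to homotopy, and degrees in
`{0, 1}` leave no coherence to check (`exists_cofibrant_model`). Finally, the composition of the
homotopy category is transported to homotopy classes. It is the one given by the folding map because
the folded path and the two given paths bound a square with one degenerate side
(`exists_fold_square`, `IsComposite.roof_eq`). -/

namespace CEDiagram

/-! ### Homotopy theory in a single P-category -/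

namespace PCategory

variable {C : Type u} [Category.{v} C] (K : PCategory C)

/-! ### The structure maps of a path -/

/-- The end points of a path. -/
def pr (k : Fin 2) (A : C) : K.P.obj A ⟶ A := (K.δ k).app A

/-- The constant path. -/
def const (A : C) : A ⟶ K.P.obj A := K.ι.app A

/-- The coproduct of a path, a square that contracts the path to its initial point. -/
def conn (A : C) : K.P.obj A ⟶ K.P.obj (K.P.obj A) := K.coprod.app A

/-- The reversed path. -/
def rev (A : C) : K.P.obj A ⟶ K.P.obj A := K.symm.app A

/-- The conjugate of the coproduct by the symmetry, a square that contracts the path to its end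
point. -/
def conn' (A : C) : K.P.obj A ⟶ K.P.obj (K.P.obj A) :=
  K.rev A ≫ K.conn A ≫ K.rev (K.P.obj A) ≫ K.P.map (K.rev A)

/-- The folding map. -/
def nabla (A : C) : K.P.obj (K.P.obj A) ⟶ K.P.obj A := K.fold.app A

variable {K} {A B X S : C}

@[simp] lemma pr_naturality (k : Fin 2) (f : A ⟶ B) :
    K.P.map f ≫ K.pr k B = K.pr k A ≫ f := (K.δ k).naturality f

@[simp] lemma pr_naturality_assoc (k : Fin 2) (f : A ⟶ B) (g : B ⟶ X) :
    K.P.map f ≫ K.pr k B ≫ g = K.pr k A ≫ f ≫ g := by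
  rw [← Category.assoc, pr_naturality, Category.assoc]

@[simp] lemma const_naturality (f : A ⟶ B) :
    K.const A ≫ K.P.map f = f ≫ K.const B := (K.ι.naturality f).symm

@[simp] lemma const_naturality_assoc (f : A ⟶ B) (g : K.P.obj B ⟶ X) :
    K.const A ≫ K.P.map f ≫ g = f ≫ K.const B ≫ g := by
  rw [← Category.assoc, const_naturality, Category.assoc]

lemma conn_naturality (f : A ⟶ B) :
    K.conn A ≫ K.P.map (K.P.map f) = K.P.map f ≫ K.conn B := (K.coprod.naturality f).symm

lemma rev_naturality (f : A ⟶ B) : K.rev A ≫ K.P.map f = K.P.map f ≫ K.rev B :=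
  (K.symm.naturality f).symm

@[simp] lemma const_pr (k : Fin 2) (A : C) : K.const A ≫ K.pr k A = 𝟙 A := K.ι_δ k A

@[simp] lemma const_pr_assoc (k : Fin 2) (f : A ⟶ X) : K.const A ≫ K.pr k A ≫ f = f := by
  rw [← Category.assoc, const_pr, Category.id_comp]

@[simp] lemma conn_pr_zero (A : C) : K.conn A ≫ K.pr 0 (K.P.obj A) = K.pr 0 A ≫ K.const A :=
  K.coprod_δ_zero A

@[simp] lemma conn_pr_one (A : C) : K.conn A ≫ K.pr 1 (K.P.obj A) = 𝟙 _ := K.coprod_δ_one A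

@[simp] lemma conn_map_pr_zero (A : C) : K.conn A ≫ K.P.map (K.pr 0 A) = K.pr 0 A ≫ K.const A :=
  K.coprod_map_δ_zero A

@[simp] lemma conn_map_pr_one (A : C) : K.conn A ≫ K.P.map (K.pr 1 A) = 𝟙 _ :=
  K.coprod_map_δ_one A

@[simp] lemma rev_rev (A : C) : K.rev A ≫ K.rev A = 𝟙 _ := K.symm_symm A

lemma const_rev (A : C) : K.const A ≫ K.rev A = K.const A := K.ι_symm A

lemma rev_pr_zero (A : C) : K.rev A ≫ K.pr 0 A = K.pr 1 A := K.symm_δ 0 A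

lemma rev_pr_one (A : C) : K.rev A ≫ K.pr 1 A = K.pr 0 A := K.symm_δ 1 A

lemma nabla_pr (k : Fin 2) (A : C) :
    K.nabla A ≫ K.pr k A = K.pr k (K.P.obj A) ≫ K.pr k A := K.fold_δ k A

lemma const_nabla (A : C) : K.const (K.P.obj A) ≫ K.nabla A = 𝟙 _ := K.ι_fold A

lemma conn'_pr_zero (A : C) : K.conn' A ≫ K.pr 0 (K.P.obj A) = 𝟙 _ := by
  have h : K.rev (K.P.obj A) ≫ K.pr 0 (K.P.obj A) ≫ K.rev A = K.pr 1 (K.P.obj A) ≫ K.rev A := by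
    rw [← Category.assoc, rev_pr_zero]
  have h' : K.conn A ≫ K.pr 1 (K.P.obj A) ≫ K.rev A = K.rev A := by
    rw [← Category.assoc, conn_pr_one, Category.id_comp]
  simp only [conn', Category.assoc, pr_naturality, h, h', rev_rev]

lemma conn'_pr_one (A : C) : K.conn' A ≫ K.pr 1 (K.P.obj A) = K.pr 1 A ≫ K.const A := by
  have h : K.rev (K.P.obj A) ≫ K.pr 1 (K.P.obj A) ≫ K.rev A = K.pr 0 (K.P.obj A) ≫ K.rev A := by
    rw [← Category.assoc, rev_pr_one]
  have h' : K.conn A ≫ K.pr 0 (K.P.obj A) ≫ K.rev A = K.pr 0 A ≫ K.const A := by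
    rw [← Category.assoc, conn_pr_zero, Category.assoc, const_rev]
  simp only [conn', Category.assoc, pr_naturality, h, h']
  rw [← Category.assoc, rev_pr_zero]

lemma conn'_map_pr_zero (A : C) : K.conn' A ≫ K.P.map (K.pr 0 A) = 𝟙 _ := by
  have h : K.rev (K.P.obj A) ≫ K.P.map (K.rev A) ≫ K.P.map (K.pr 0 A) =
      K.P.map (K.pr 1 A) ≫ K.rev A := by
    rw [← Functor.map_comp, rev_pr_zero, rev_naturality]
  simp only [conn', Category.assoc, h]
  rw [← Category.assoc (K.conn A), conn_map_pr_one, Category.id_comp, rev_rev]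

lemma conn'_map_pr_one (A : C) : K.conn' A ≫ K.P.map (K.pr 1 A) = K.pr 1 A ≫ K.const A := by
  have h : K.rev (K.P.obj A) ≫ K.P.map (K.rev A) ≫ K.P.map (K.pr 1 A) =
      K.P.map (K.pr 0 A) ≫ K.rev A := by
    rw [← Functor.map_comp, rev_pr_one, rev_naturality]
  simp only [conn', Category.assoc, h]
  rw [← Category.assoc (K.conn A), conn_map_pr_zero, Category.assoc, const_rev,
    ← Category.assoc, rev_pr_zero]

lemma fib_pr (k : Fin 2) (A : C) : K.fib (K.pr k A) := K.fib_δ k A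

lemma weq_pr (k : Fin 2) (A : C) : K.weq (K.pr k A) := K.weq_δ k A

lemma weq_comp {f : A ⟶ B} {g : B ⟶ X} (hf : K.weq f) (hg : K.weq g) : K.weq (f ≫ g) :=
  have := K.weq_comp_and_two_of_three
  K.weq.comp_mem f g hf hg

lemma weq_of_postcomp {f : A ⟶ B} {g : B ⟶ X} (hg : K.weq g) (hfg : K.weq (f ≫ g)) : K.weq f :=
  have := K.weq_comp_and_two_of_three
  K.weq.of_postcomp f g hg hfg

/-! ### The path of the final object -/

/-- The two end points of a path in a final object agree, so the coproduct exhibits the identity of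
its path object as a map through that object. This makes the `P(B)` component of a cocylinder over
the final object carry no information. -/
lemma hom_path_terminal_ext {E : C} (hE : IsTerminal E) (f g : S ⟶ K.P.obj E) : f = g := by
  have h : 𝟙 (K.P.obj E) = K.pr 0 E ≫ K.const E := by
    rw [← conn_map_pr_one, hE.hom_ext (K.pr 1 E) (K.pr 0 E), conn_map_pr_zero]
  rw [← Category.comp_id f, ← Category.comp_id g, h, ← Category.assoc, ← Category.assoc,
    hE.hom_ext (f ≫ K.pr 0 E) (g ≫ K.pr 0 E)]

lemma nonempty_isTerminal_path {E : C} (hE : IsTerminal E) : Nonempty (IsTerminal (K.P.obj E)) :=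
  ⟨IsTerminal.ofUniqueHom (fun Y => hE.from Y ≫ K.const E) fun _ _ => hom_path_terminal_ext hE _ _⟩

/-! ### Lifting along fibrations -/

/-- Fibre products that represent the end points and the image in `B` of a path in `A`, for a
morphism `v : A ⟶ B`. -/
structure Cocylinder (K : PCategory C) (v : A ⟶ B) where
  N : C
  V : C
  n₁ : N ⟶ A
  n₂ : N ⟶ K.P.obj B
  hN : IsPullback n₁ n₂ v (K.pr 0 B)
  m₁ : V ⟶ N
  m₂ : V ⟶ A
  hV : IsPullback m₁ m₂ (n₂ ≫ K.pr 1 B) v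

lemma nonempty_cocylinder {v : A ⟶ B} (hv : K.fib v) : Nonempty (Cocylinder K v) := by
  have := K.hasPullback v (K.pr 0 B) (fib_pr _ _)
  have := K.hasPullback (pullback.snd v (K.pr 0 B) ≫ K.pr 1 B) v hv
  exact ⟨⟨_, _, _, _, IsPullback.of_hasPullback _ _, _, _, IsPullback.of_hasPullback _ _⟩⟩

namespace Cocylinder

variable {v : A ⟶ B} (c : Cocylinder K v)

def source : c.V ⟶ A := c.m₁ ≫ c.n₁

def target : c.V ⟶ A := c.m₂

def path : c.V ⟶ K.P.obj B := c.m₁ ≫ c.n₂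

lemma source_comp : c.source ≫ v = c.path ≫ K.pr 0 B := by
  simp only [source, path, Category.assoc, c.hN.w]

lemma target_comp : c.target ≫ v = c.path ≫ K.pr 1 B := by
  simp only [target, path, Category.assoc, ← c.hV.w]

variable {c} in
lemma hom_ext {s t : S ⟶ c.V} (h₀ : s ≫ c.source = t ≫ c.source)
    (h₁ : s ≫ c.target = t ≫ c.target) (h : s ≫ c.path = t ≫ c.path) : s = t := by
  refine c.hV.hom_ext (c.hN.hom_ext ?_ ?_) h₁
  · simpa [source] using h₀
  · simpa [path] using h

lemma exists_lift (x₀ x₁ : S ⟶ A) (γ : S ⟶ K.P.obj B) (h₀ : x₀ ≫ v = γ ≫ K.pr 0 B)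
    (h₁ : x₁ ≫ v = γ ≫ K.pr 1 B) :
    ∃ s : S ⟶ c.V, s ≫ c.source = x₀ ∧ s ≫ c.target = x₁ ∧ s ≫ c.path = γ := by
  refine ⟨c.hV.lift (c.hN.lift x₀ γ h₀) x₁ ?_, ?_, ?_, ?_⟩
  · rw [← Category.assoc, c.hN.lift_snd, h₁]
  · rw [source, ← Category.assoc, c.hV.lift_fst, c.hN.lift_fst]
  · rw [target, c.hV.lift_snd]
  · rw [path, ← Category.assoc, c.hV.lift_fst, c.hN.lift_snd]

lemma isPullback_map_hN : IsPullback (K.P.map c.n₁) (K.P.map c.n₂) (K.P.map v)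
    (K.P.map (K.pr 0 B)) := K.isPullback_map c.hN (fib_pr _ _)

lemma isPullback_map_hV (hv : K.fib v) : IsPullback (K.P.map c.m₁) (K.P.map c.m₂)
    (K.P.map (c.n₂ ≫ K.pr 1 B)) (K.P.map v) := K.isPullback_map c.hV hv

variable {c} in
lemma map_hom_ext (hv : K.fib v) {s t : S ⟶ K.P.obj c.V}
    (h₀ : s ≫ K.P.map c.source = t ≫ K.P.map c.source)
    (h₁ : s ≫ K.P.map c.target = t ≫ K.P.map c.target)
    (h : s ≫ K.P.map c.path = t ≫ K.P.map c.path) : s = t := by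
  refine (c.isPullback_map_hV hv).hom_ext (c.isPullback_map_hN.hom_ext ?_ ?_) h₁
  · simpa [source] using h₀
  · simpa [path] using h

/-- Since `P` preserves both fibre products that define `V`, a path in `V` amounts to a compatible
triple of paths. -/
lemma exists_map_lift (hv : K.fib v) (x₀ x₁ : S ⟶ K.P.obj A) (γ : S ⟶ K.P.obj (K.P.obj B))
    (h₀ : x₀ ≫ K.P.map v = γ ≫ K.P.map (K.pr 0 B))
    (h₁ : x₁ ≫ K.P.map v = γ ≫ K.P.map (K.pr 1 B)) :
    ∃ s : S ⟶ K.P.obj c.V, s ≫ K.P.map c.source = x₀ ∧ s ≫ K.P.map c.target = x₁ ∧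
      s ≫ K.P.map c.path = γ := by
  have hN := c.isPullback_map_hN
  have hV := c.isPullback_map_hV hv
  refine ⟨hV.lift (hN.lift x₀ γ h₀) x₁ ?_, ?_, ?_, ?_⟩
  · rw [Functor.map_comp, ← Category.assoc, hN.lift_snd, h₁]
  · rw [source, K.P.map_comp c.m₁ c.n₁, ← Category.assoc, hV.lift_fst, hN.lift_fst]
  · rw [target, hV.lift_snd]
  · rw [path, K.P.map_comp c.m₁ c.n₂, ← Category.assoc, hV.lift_fst, hN.lift_snd]

/-- The morphism from the path object of `A`. -/
noncomputable def map : K.P.obj A ⟶ c.V :=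
  (c.exists_lift (K.pr 0 A) (K.pr 1 A) (K.P.map v) (by simp) (by simp)).choose

@[simp] lemma map_source : c.map ≫ c.source = K.pr 0 A :=
  (c.exists_lift (K.pr 0 A) (K.pr 1 A) (K.P.map v) (by simp) (by simp)).choose_spec.1

@[simp] lemma map_target : c.map ≫ c.target = K.pr 1 A :=
  (c.exists_lift (K.pr 0 A) (K.pr 1 A) (K.P.map v) (by simp) (by simp)).choose_spec.2.1

@[simp] lemma map_path : c.map ≫ c.path = K.P.map v :=
  (c.exists_lift (K.pr 0 A) (K.pr 1 A) (K.P.map v) (by simp) (by simp)).choose_spec.2.2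

/-- The iterated fibre product `V` is also the double mapping path over `A ⨯ A`, so the fifth axiom
applies to it. -/
lemma fib_map (hv : K.fib v) : K.fib c.map := by
  have := K.hasFiniteProducts
  have hp : IsPullback (prod.lift c.source c.target) c.path (prod.map v v)
      (prod.lift (K.pr 0 B) (K.pr 1 B)) := by
    have h (s : PullbackCone (prod.map v v) (prod.lift (K.pr 0 B) (K.pr 1 B))) :=
      c.exists_lift (s.fst ≫ prod.fst) (s.fst ≫ prod.snd) s.snd
        (by simpa [prod.lift_fst] using s.condition =≫ prod.fst)
        (by simpa [prod.lift_snd] using s.condition =≫ prod.snd)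
    refine ⟨⟨?_⟩, ⟨PullbackCone.IsLimit.mk _ (fun s => (h s).choose) (fun s => ?_)
      (fun s => (h s).choose_spec.2.2) fun s m h₁ h₂ => ?_⟩⟩
    · ext
      · simpa [prod.lift_fst] using c.source_comp
      · simpa [prod.lift_snd] using c.target_comp
    · ext
      · simpa [prod.lift_fst] using (h s).choose_spec.1
      · simpa [prod.lift_snd] using (h s).choose_spec.2.1
    · refine hom_ext (.trans ?_ (h s).choose_spec.1.symm) (.trans ?_ (h s).choose_spec.2.1.symm)
        (h₂.trans (h s).choose_spec.2.2.symm)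
      · simpa [prod.lift_fst] using h₁ =≫ prod.fst
      · simpa [prod.lift_snd] using h₁ =≫ prod.snd
  have hl : c.map ≫ prod.lift c.source c.target = prod.lift (K.pr 0 A) (K.pr 1 A) := by
    ext
    · simp [prod.lift_fst]
    · simp [prod.lift_snd]
  exact K.fib_double v _ _ c.map hv hp hl c.map_path

/-- The projection of `V` to `P(B)` is a composite of base changes of the trivial fibration `v`, and
its composite with `c.map` is `P(v)`; two out of three concludes. -/
lemma weq_map (hv : K.fib v) (hv' : K.weq v) : K.weq c.map := by
  have h₁ : K.weq c.m₁ := K.weq_pullback c.hV hv hv'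
  have h₂ : K.weq c.n₂ := K.weq_pullback c.hN.flip hv hv'
  have h₃ : K.weq (c.map ≫ c.path) := by
    rw [map_path]; exact K.weq_map v hv'
  exact weq_of_postcomp (weq_comp h₁ h₂) h₃

end Cocylinder

/-- A trivial fibration has the relative path lifting property with given end points. -/
lemma Cofibrant.exists_path_lift (hS : K.Cofibrant S) {v : A ⟶ B} (hv : K.fib v) (hv' : K.weq v)
    (x₀ x₁ : S ⟶ A) (γ : S ⟶ K.P.obj B) (h₀ : x₀ ≫ v = γ ≫ K.pr 0 B)
    (h₁ : x₁ ≫ v = γ ≫ K.pr 1 B) :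
    ∃ s : S ⟶ K.P.obj A, s ≫ K.pr 0 A = x₀ ∧ s ≫ K.pr 1 A = x₁ ∧ s ≫ K.P.map v = γ := by
  obtain ⟨c⟩ := nonempty_cocylinder hv
  obtain ⟨t, rfl, rfl, rfl⟩ := c.exists_lift x₀ x₁ γ h₀ h₁
  obtain ⟨s, rfl⟩ := hS c.map t (c.fib_map hv) (c.weq_map hv hv')
  exact ⟨s, by simp, by simp, by simp⟩

/-- A trivial fibration has the relative lifting property for squares with given boundary. -/
lemma Cofibrant.exists_square_lift (hS : K.Cofibrant S) {v : A ⟶ B} (hv : K.fib v)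
    (hv' : K.weq v) (x₀ x₁ y₀ y₁ : S ⟶ K.P.obj A) (γ : S ⟶ K.P.obj (K.P.obj B))
    (h₀₀ : x₀ ≫ K.pr 0 A = y₀ ≫ K.pr 0 A) (h₀₁ : x₀ ≫ K.pr 1 A = y₁ ≫ K.pr 0 A)
    (h₁₀ : x₁ ≫ K.pr 0 A = y₀ ≫ K.pr 1 A) (h₁₁ : x₁ ≫ K.pr 1 A = y₁ ≫ K.pr 1 A)
    (hx₀ : x₀ ≫ K.P.map v = γ ≫ K.pr 0 (K.P.obj B))
    (hx₁ : x₁ ≫ K.P.map v = γ ≫ K.pr 1 (K.P.obj B))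
    (hy₀ : y₀ ≫ K.P.map v = γ ≫ K.P.map (K.pr 0 B))
    (hy₁ : y₁ ≫ K.P.map v = γ ≫ K.P.map (K.pr 1 B)) :
    ∃ s : S ⟶ K.P.obj (K.P.obj A), s ≫ K.pr 0 (K.P.obj A) = x₀ ∧ s ≫ K.pr 1 (K.P.obj A) = x₁ ∧
      s ≫ K.P.map (K.pr 0 A) = y₀ ∧ s ≫ K.P.map (K.pr 1 A) = y₁ ∧
      s ≫ K.P.map (K.P.map v) = γ := by
  obtain ⟨c⟩ := nonempty_cocylinder hv
  obtain ⟨t, rfl, rfl, rfl⟩ := c.exists_map_lift hv y₀ y₁ γ hy₀ hy₁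
  simp only [Category.assoc, pr_naturality] at h₀₀ h₀₁ h₁₀ h₁₁ hx₀ hx₁
  -- A square in `A` is a path in `P(A)`. The prescribed image `γ` and sides `y₀`, `y₁` form a path
  -- `t` in `V`, which is lifted along the trivial fibration `P(A) ⟶ V` with end points `x₀`, `x₁`.
  obtain ⟨s, h₀, h₁, rfl⟩ := hS.exists_path_lift (c.fib_map hv) (c.weq_map hv hv') x₀ x₁ t
    (Cocylinder.hom_ext (by simpa using h₀₀) (by simpa using h₀₁) (by simpa using hx₀))
    (Cocylinder.hom_ext (by simpa using h₁₀) (by simpa using h₁₁) (by simpa using hx₁))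
  refine ⟨s, h₀, h₁, ?_, ?_, ?_⟩ <;> simp [← Functor.map_comp]

/-- Fibrations have the path lifting property. -/
lemma Cofibrant.exists_path_lift_of_fib (hS : K.Cofibrant S) {v : A ⟶ B} (hv : K.fib v)
    (x : S ⟶ A) (γ : S ⟶ K.P.obj B) (h : x ≫ v = γ ≫ K.pr 0 B) :
    ∃ s : S ⟶ K.P.obj A, s ≫ K.pr 0 A = x ∧ s ≫ K.P.map v = γ := by
  obtain ⟨c⟩ := nonempty_cocylinder hv
  have hf : K.fib (c.map ≫ c.m₁) := K.fib_comp _ _ (c.fib_map hv) (K.fib_pullback c.hV hv)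
  -- The map `P(A) ⟶ N` becomes `δ 0` after the trivial fibration `N ⟶ A`, hence is a weak
  -- equivalence even when `v` is not.
  have hw : K.weq (c.map ≫ c.m₁) := by
    refine weq_of_postcomp (K.weq_pullback c.hN (fib_pr _ _) (weq_pr _ _)) ?_
    rw [Category.assoc]
    have := c.map_source
    rw [Cocylinder.source] at this
    rw [this]
    exact weq_pr _ _
  obtain ⟨s, hs⟩ := hS _ (c.hN.lift x γ h) hf hw
  have h₁ := hs =≫ c.n₁
  have h₂ := hs =≫ c.n₂
  have h₃ := c.map_source
  have h₄ := c.map_path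
  rw [Cocylinder.source] at h₃
  rw [Cocylinder.path] at h₄
  simp only [Category.assoc, h₃, h₄, IsPullback.lift_fst, IsPullback.lift_snd] at h₁ h₂
  exact ⟨s, h₁, h₂⟩

/-- The folding of two successive paths is, up to a square with a degenerate side, the composite
of the two paths. -/
lemma Cofibrant.exists_fold_square (hS : K.Cofibrant S) (l : S ⟶ K.P.obj (K.P.obj X)) :
    ∃ s : S ⟶ K.P.obj (K.P.obj X),
      s ≫ K.pr 0 (K.P.obj X) = l ≫ K.pr 0 (K.P.obj X) ∧
      s ≫ K.pr 1 (K.P.obj X) = l ≫ K.pr 1 (K.P.obj X) ≫ K.pr 1 X ≫ K.const X ∧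
      s ≫ K.P.map (K.pr 0 X) = l ≫ K.nabla X ∧
      s ≫ K.P.map (K.pr 1 X) = l ≫ K.P.map (K.pr 1 X) := by
  have := K.hasFiniteProducts
  have hE : IsTerminal (⊤_ C) := terminalIsTerminal
  obtain ⟨hE₁⟩ := nonempty_isTerminal_path (K := K) hE
  obtain ⟨hE₂⟩ := nonempty_isTerminal_path (K := K) hE₁
  have hv := K.fib_terminal X
  -- Over the final object, `c.V` is `X × X`, and `d.V` is the object of boundaries of squares in
  -- `X`; the fibration `d.map` sends a square to its boundary. The map `b` below is the boundary to
  -- be filled, for the universal `l`.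
  obtain ⟨c⟩ := nonempty_cocylinder hv
  obtain ⟨d⟩ := nonempty_cocylinder (c.fib_map hv)
  obtain ⟨t, ht₀, ht₁, -⟩ := c.exists_map_lift hv (K.nabla X) (K.P.map (K.pr 1 X)) (hE₂.from _)
    (hE₁.hom_ext _ _) (hE₁.hom_ext _ _)
  have ht₀' (k : Fin 2) : (t ≫ K.pr k _) ≫ c.source = K.pr k _ ≫ K.pr k X := by
    rw [Category.assoc, ← pr_naturality, ← Category.assoc, ht₀, nabla_pr]
  have ht₁' (k : Fin 2) : (t ≫ K.pr k _) ≫ c.target = K.pr k _ ≫ K.pr 1 X := by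
    rw [Category.assoc, ← pr_naturality, ← Category.assoc, ht₁, pr_naturality]
  obtain ⟨b, hb₀, hb₁, hb⟩ := d.exists_lift (K.pr 0 (K.P.obj X))
    (K.pr 1 (K.P.obj X) ≫ K.pr 1 X ≫ K.const X) t
    (Cocylinder.hom_ext (by rw [ht₀']; simp) (by rw [ht₁']; simp) (hE₁.hom_ext _ _))
    (Cocylinder.hom_ext (by rw [ht₀']; simp) (by rw [ht₁']; simp) (hE₁.hom_ext _ _))
  -- On squares that are constant in the outer direction the folding is trivial, and the boundary is
  -- filled by `conn'`.
  have key : K.const (K.P.obj X) ≫ b = K.conn' X ≫ d.map := by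
    refine Cocylinder.hom_ext ?_ ?_ (Cocylinder.map_hom_ext hv ?_ ?_ (hE₂.hom_ext _ _))
    · simp [hb₀, conn'_pr_zero]
    · simp [hb₁, conn'_pr_one]
    · simp [hb, ht₀, ← Functor.map_comp, const_nabla, conn'_map_pr_zero]
    · simp [hb, ht₁, ← Functor.map_comp, conn'_map_pr_one]
  -- The coproduct of `P X` contracts `l` to the constant square at its initial side. Its image
  -- under `b` is a path of boundaries starting at one already filled; lifting that path and taking
  -- its end point fills the boundary of `l`.
  obtain ⟨s, hs₀, hs⟩ := hS.exists_path_lift_of_fib (d.fib_map (c.fib_map hv))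
    (l ≫ K.pr 0 (K.P.obj X) ≫ K.conn' X) (l ≫ K.conn (K.P.obj X) ≫ K.P.map b) (by
      simp only [Category.assoc, pr_naturality, ← key]
      rw [← Category.assoc (K.conn _), conn_pr_zero, Category.assoc])
  have hs' : (s ≫ K.pr 1 _) ≫ d.map = l ≫ b := by
    rw [Category.assoc, ← pr_naturality, ← Category.assoc, hs]
    simp only [Category.assoc, pr_naturality]
    rw [← Category.assoc (K.conn _), conn_pr_one, Category.id_comp]
  have e₀ := hs' =≫ d.source
  have e₁ := hs' =≫ d.target
  have e := hs' =≫ d.path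
  simp only [Category.assoc, Cocylinder.map_source, Cocylinder.map_target, Cocylinder.map_path,
    hb₀, hb₁, hb] at e₀ e₁ e
  refine ⟨s ≫ K.pr 1 _, by simpa using e₀, by simpa using e₁, ?_, ?_⟩
  · simpa [← Functor.map_comp, ht₀] using e =≫ K.P.map c.source
  · simpa [← Functor.map_comp, ht₁] using e =≫ K.P.map c.target

/-! ### Factorization through the mapping path -/

variable {N : C} {w : A ⟶ B} {p : N ⟶ A} {q : N ⟶ K.P.obj B}

/-- The map factors through `A ⨯ B`: the first factor is a base change of `(δ 0, δ 1)`, the second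
one of the fibration from `A` to the final object. -/
lemma fib_mappingPath (h : IsPullback p q w (K.pr 0 B)) : K.fib (q ≫ K.pr 1 B) := by
  have := K.hasFiniteProducts
  have h₁ : K.fib (prod.lift p (q ≫ K.pr 1 B)) := by
    refine K.fib_pullback (q := q) (f := prod.map w (𝟙 B)) (g := prod.lift (K.pr 0 B) (K.pr 1 B))
      ?_ (K.fib_δ_δ B)
    refine ⟨⟨?_⟩, ⟨PullbackCone.IsLimit.mk _ (fun s => h.lift (s.fst ≫ prod.fst) s.snd
      (by simpa [prod.lift_fst] using s.condition =≫ prod.fst)) (fun s => ?_) (fun s => ?_)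
      fun s m h' h'' => ?_⟩⟩
    · ext
      · simpa [prod.lift_fst, prod.lift_snd] using h.w
      · simp [prod.lift_snd]
    · ext
      · simp [prod.lift_fst]
      · simpa [prod.lift_fst, prod.lift_snd] using (s.condition =≫ prod.snd).symm
    · simp
    · refine h.hom_ext ?_ ?_
      · simpa [prod.lift_fst, prod.lift_snd] using h' =≫ prod.fst
      · simpa [prod.lift_fst, prod.lift_snd] using h''
  have h₂ : K.fib (prod.snd : A ⨯ B ⟶ B) := by
    refine K.fib_pullback (q := prod.fst) (f := terminal.from B) (g := terminal.from A) ?_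
      (K.fib_terminal A)
    exact IsPullback.of_is_product (BinaryFan.isLimitFlip (prodIsProd A B)) terminalIsTerminal
  simpa [prod.lift_snd] using K.fib_comp _ _ h₁ h₂

lemma weq_mappingPath (h : IsPullback p q w (K.pr 0 B)) (hw : K.weq w) (k : Fin 2) :
    K.weq (q ≫ K.pr k B) :=
  weq_comp (K.weq_pullback' h (fib_pr _ _) hw) (weq_pr _ _)

/-- A morphism from a cofibrant object lifts along a weak equivalence up to homotopy. -/
lemma Cofibrant.exists_lift_up_to_homotopy (hS : K.Cofibrant S) (hw : K.weq w) (x : S ⟶ B) :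
    ∃ (y : S ⟶ A) (γ : S ⟶ K.P.obj B), γ ≫ K.pr 0 B = y ≫ w ∧ γ ≫ K.pr 1 B = x := by
  have := K.hasPullback w (K.pr 0 B) (fib_pr _ _)
  have h := IsPullback.of_hasPullback w (K.pr 0 B)
  obtain ⟨s, hs⟩ := hS _ x (fib_mappingPath h) (weq_mappingPath h hw 1)
  refine ⟨s ≫ pullback.fst _ _, s ≫ pullback.snd _ _, ?_, by simpa using hs⟩
  rw [Category.assoc, Category.assoc, pullback.condition]

end PCategory

end CEDiagram

/-! ### Ho-morphisms of diagrams and the section of the mapping path -/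

namespace CEDiagram

variable {I : Type w} [SmallCategory I]

open PCategory

/-! ### The path of a diagram -/

namespace DiagramData

variable (D : DiagramData.{w, v, u} I) {i j : I} (a : i ⟶ j)

/-- The comparison of the path objects under a transition functor. -/
def swap (X : D.F.obj i) :
    (D.push a).obj ((D.K i).P.obj X) ⟶ (D.K j).P.obj ((D.push a).obj X) :=
  (D.T a).θ.hom.app X

lemma swap_naturality {X Y : D.F.obj i} (f : X ⟶ Y) :
    (D.push a).map ((D.K i).P.map f) ≫ D.swap a Y =
      D.swap a X ≫ (D.K j).P.map ((D.push a).map f) :=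
  (D.T a).θ.hom.naturality f

lemma const_swap (X : D.F.obj i) :
    (D.push a).map ((D.K i).const X) ≫ D.swap a X = (D.K j).const ((D.push a).obj X) :=
  (D.T a).θ_ι X

lemma swap_pr (k : Fin 2) (X : D.F.obj i) :
    D.swap a X ≫ (D.K j).pr k ((D.push a).obj X) = (D.push a).map ((D.K i).pr k X) :=
  (D.T a).θ_δ k X

lemma conn_swap (X : D.F.obj i) :
    (D.push a).map ((D.K i).conn X) ≫ D.swap a ((D.K i).P.obj X) ≫ (D.K j).P.map (D.swap a X) =
      D.swap a X ≫ (D.K j).conn ((D.push a).obj X) :=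
  (D.T a).θ_coprod X

end DiagramData

variable {D : DiagramData.{w, v, u} I}

namespace Diagram

variable {A B X : Diagram D}

lemma hom_ext {f g : A ⟶ B} (h : ∀ i, f.app i = g.app i) : f = g := Hom.ext (funext h)

@[simp] lemma id_app (A : Diagram D) (i : I) : Hom.app (𝟙 A) i = 𝟙 (A.obj i) := rfl

@[simp] lemma comp_app (f : A ⟶ B) (g : B ⟶ X) (i : I) : (f ≫ g).app i = f.app i ≫ g.app i := rfl

lemma comm (f : A ⟶ B) {i j : I} (a : i ⟶ j) (ha : NonIdentity a) :
    (D.push a).map (f.app i) ≫ B.φ a ha = A.φ a ha ≫ f.app j := Hom.comm f a ha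

/-- The constant path as a morphism of diagrams. -/
def pathConst (B : Diagram D) : B ⟶ B.path where
  app i := (D.K i).const (B.obj i)
  comm {i j} a ha := by
    change (D.push a).map ((D.K i).const (B.obj i)) ≫ D.swap a (B.obj i) ≫
      (D.K j).P.map (B.φ a ha) = B.φ a ha ≫ (D.K j).const (B.obj j)
    rw [← Category.assoc, D.const_swap, const_naturality]

/-- The coproduct of the path as a morphism of diagrams. -/
def pathConn (B : Diagram D) : B.path ⟶ B.path.path where
  app i := (D.K i).conn (B.obj i)
  comm {i j} a ha := by
    change (D.push a).map ((D.K i).conn (B.obj i)) ≫ D.swap a ((D.K i).P.obj (B.obj i)) ≫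
      (D.K j).P.map (D.swap a (B.obj i) ≫ (D.K j).P.map (B.φ a ha)) =
        (D.swap a (B.obj i) ≫ (D.K j).P.map (B.φ a ha)) ≫ (D.K j).conn (B.obj j)
    rw [Category.assoc, ← conn_naturality, ← Category.assoc (D.swap a (B.obj i)), ← D.conn_swap,
      Functor.map_comp]
    simp only [Category.assoc]

/-- The path of a morphism of diagrams. -/
def pathMap (f : A ⟶ B) : A.path ⟶ B.path where
  app i := (D.K i).P.map (f.app i)
  comm {i j} a ha := by
    change (D.push a).map ((D.K i).P.map (f.app i)) ≫ D.swap a (B.obj i) ≫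
      (D.K j).P.map (B.φ a ha) =
        (D.swap a (A.obj i) ≫ (D.K j).P.map (A.φ a ha)) ≫ (D.K j).P.map (f.app j)
    rw [← Category.assoc, D.swap_naturality, Category.assoc, Category.assoc, ← Functor.map_comp,
      ← Functor.map_comp, comm]

lemma pathConst_pathδ (k : Fin 2) (B : Diagram D) : pathConst B ≫ pathδ k B = 𝟙 B :=
  hom_ext fun _ => const_pr _ _

lemma pathConn_pathδ_zero (B : Diagram D) :
    pathConn B ≫ pathδ 0 B.path = pathδ 0 B ≫ pathConst B :=
  hom_ext fun _ => conn_pr_zero _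

lemma pathConn_pathδ_one (B : Diagram D) : pathConn B ≫ pathδ 1 B.path = 𝟙 B.path :=
  hom_ext fun _ => conn_pr_one _

lemma pathMap_pathδ (k : Fin 2) (f : A ⟶ B) : pathMap f ≫ pathδ k B = pathδ k A ≫ f :=
  hom_ext fun _ => pr_naturality _ _

end Diagram

open Diagram

/-! ### Ho-morphisms -/

namespace HoHom

variable {A B X Y : Diagram D}

lemma hoHom_ext {f g : HoHom A B} (h : ∀ i, f.app i = g.app i)
    (h' : ∀ (i j : I) (a : i ⟶ j) (ha : NonIdentity a), f.htpy a ha = g.htpy a ha) : f = g :=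
  HoHom.ext (funext h) (by funext i j a ha; exact h' i j a ha)

/-- A ho-morphism given by level-wise morphisms and homotopies. -/
def ofPr (app : ∀ i : I, A.obj i ⟶ B.obj i)
    (htpy : ∀ {i j : I} (a : i ⟶ j), NonIdentity a →
      ((D.push a).obj (A.obj i) ⟶ (D.K j).P.obj (B.obj j)))
    (h₀ : ∀ {i j : I} (a : i ⟶ j) (ha : NonIdentity a),
      htpy a ha ≫ (D.K j).pr 0 (B.obj j) = A.φ a ha ≫ app j)
    (h₁ : ∀ {i j : I} (a : i ⟶ j) (ha : NonIdentity a),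
      htpy a ha ≫ (D.K j).pr 1 (B.obj j) = (D.push a).map (app i) ≫ B.φ a ha) : HoHom A B :=
  ⟨app, htpy, h₀, h₁⟩

section

variable (f : HoHom A B) (i : I) {j : I} (a : i ⟶ j) (ha : NonIdentity a)

lemma htpy_pr_zero : f.htpy a ha ≫ (D.K j).pr 0 (B.obj j) = A.φ a ha ≫ f.app j :=
  f.htpy_zero a ha

lemma htpy_pr_one : f.htpy a ha ≫ (D.K j).pr 1 (B.obj j) = (D.push a).map (f.app i) ≫ B.φ a ha :=
  f.htpy_one a ha

@[simp] lemma ofHom_app (f : A ⟶ B) : (ofHom f).app i = f.app i := rfl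

@[simp] lemma ofHom_htpy (f : A ⟶ B) :
    (ofHom f).htpy a ha = (A.φ a ha ≫ f.app j) ≫ (D.K j).const (B.obj j) := rfl

@[simp] lemma comp_app (g : B ⟶ X) : (f.comp g).app i = f.app i ≫ g.app i := rfl

@[simp] lemma comp_htpy (g : B ⟶ X) :
    (f.comp g).htpy a ha = f.htpy a ha ≫ (D.K j).P.map (g.app j) := rfl

@[simp] lemma precomp_app (g : X ⟶ A) : (precomp g f).app i = g.app i ≫ f.app i := rfl

@[simp] lemma precomp_htpy (g : X ⟶ A) :
    (precomp g f).htpy a ha = (D.push a).map (g.app i) ≫ f.htpy a ha := rfl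

end

lemma comp_id (f : HoHom A B) : f.comp (𝟙 B) = f :=
  hoHom_ext (by simp) (by simp)

lemma comp_comp (f : HoHom A B) (g : B ⟶ X) (h : X ⟶ Y) : (f.comp g).comp h = f.comp (g ≫ h) :=
  hoHom_ext (by simp) (by simp)

lemma ofHom_comp (f : A ⟶ B) (g : B ⟶ X) : (ofHom f).comp g = ofHom (f ≫ g) :=
  hoHom_ext (by simp) (by simp)

lemma precomp_ofHom (f : A ⟶ B) (g : B ⟶ X) : (ofHom g).precomp f = ofHom (f ≫ g) :=
  hoHom_ext (by simp) fun i j a ha => by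
    simp only [precomp_htpy, ofHom_htpy, ← Category.assoc, Diagram.comm, Diagram.comp_app]

lemma Homotopic.comp {f g : HoHom A B} (h : Homotopic f g) (r : B ⟶ X) :
    Homotopic (f.comp r) (g.comp r) := by
  obtain ⟨h, rfl, rfl⟩ := h
  exact ⟨h.comp (pathMap r), by rw [comp_comp, comp_comp, pathMap_pathδ],
    by rw [comp_comp, comp_comp, pathMap_pathδ]⟩

lemma Homotopic.refl (f : HoHom A B) : Homotopic f f :=
  ⟨f.comp (pathConst B), by rw [comp_comp, pathConst_pathδ, comp_id],
    by rw [comp_comp, pathConst_pathδ, comp_id]⟩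

/-! ### The mapping path -/

section MappingPath

variable (f : HoHom A B) (i : I) {j : I} (a : i ⟶ j) (ha : NonIdentity a)

/-- The first projection of the mapping path at a vertex. -/
noncomputable def mpFst : f.mappingPath.obj i ⟶ A.obj i :=
  pullback.fst (f.app i) (((D.K i).δ 0).app (B.obj i))

/-- The second projection of the mapping path at a vertex. -/
noncomputable def mpSnd : f.mappingPath.obj i ⟶ (D.K i).P.obj (B.obj i) :=
  pullback.snd (f.app i) (((D.K i).δ 0).app (B.obj i))

lemma isPullback_mp :
    IsPullback (f.mpFst i) (f.mpSnd i) (f.app i) ((D.K i).pr 0 (B.obj i)) :=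
  IsPullback.of_hasPullback _ _

lemma isPullback_map_mp :
    IsPullback ((D.K i).P.map (f.mpFst i)) ((D.K i).P.map (f.mpSnd i)) ((D.K i).P.map (f.app i))
      ((D.K i).P.map ((D.K i).pr 0 (B.obj i))) :=
  (D.K i).isPullback_map (f.isPullback_mp i) (fib_pr _ _)

/-- The morphism `(φ_a, F_a)` to the mapping path. -/
noncomputable def edge : (D.push a).obj (A.obj i) ⟶ f.mappingPath.obj j :=
  (f.isPullback_mp j).lift (A.φ a ha) (f.htpy a ha) (f.htpy_pr_zero i a ha).symm

@[simp] lemma edge_mpFst : f.edge i a ha ≫ f.mpFst j = A.φ a ha := IsPullback.lift_fst _ _ _ _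

@[simp] lemma edge_mpSnd : f.edge i a ha ≫ f.mpSnd j = f.htpy a ha := IsPullback.lift_snd _ _ _ _

lemma mappingPath_φ : f.mappingPath.φ a ha = (D.push a).map (f.mpFst i) ≫ f.edge i a ha := by
  refine (f.isPullback_mp j).hom_ext ?_ ?_
  · rw [Category.assoc, edge_mpFst]
    simp only [mappingPath, Category.assoc, mpFst]
    exact congrArg _ (pullback.lift_fst _ _ _)
  · rw [Category.assoc, edge_mpSnd]
    simp only [mappingPath, Category.assoc, mpSnd]
    exact congrArg _ (pullback.lift_snd _ _ _)

@[simp] lemma mappingPathFst_app : f.mappingPathFst.app i = f.mpFst i := rfl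

@[simp] lemma mappingPathSnd_app :
    f.mappingPathSnd.app i = f.mpSnd i ≫ (D.K i).pr (D.deg i) (B.obj i) := rfl

end MappingPath

/-- A morphism of diagrams to a mapping path. -/
noncomputable def liftMappingPath (f : HoHom A B) (r : X ⟶ A)
    (s : ∀ i, X.obj i ⟶ (D.K i).P.obj (B.obj i))
    (h : ∀ i, r.app i ≫ f.app i = s i ≫ (D.K i).pr 0 (B.obj i))
    (h' : ∀ (i j : I) (a : i ⟶ j) (ha : NonIdentity a),
      (D.push a).map (r.app i) ≫ f.htpy a ha = X.φ a ha ≫ s j) : X ⟶ f.mappingPath where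
  app i := (f.isPullback_mp i).lift (r.app i) (s i) (h i)
  comm {i j} a ha := by
    rw [mappingPath_φ, ← Category.assoc, ← Functor.map_comp, IsPullback.lift_fst]
    refine (f.isPullback_mp j).hom_ext ?_ ?_
    · simp only [Category.assoc, edge_mpFst, IsPullback.lift_fst, Diagram.comm]
    · simp only [Category.assoc, edge_mpSnd, IsPullback.lift_snd, h']

section

variable (f : HoHom A B) (r : X ⟶ A) (s : ∀ i, X.obj i ⟶ (D.K i).P.obj (B.obj i))
    (h : ∀ i, r.app i ≫ f.app i = s i ≫ (D.K i).pr 0 (B.obj i))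
    (h' : ∀ (i j : I) (a : i ⟶ j) (ha : NonIdentity a),
      (D.push a).map (r.app i) ≫ f.htpy a ha = X.φ a ha ≫ s j)

lemma liftMappingPath_fst : f.liftMappingPath r s h h' ≫ f.mappingPathFst = r :=
  Diagram.hom_ext fun _ => IsPullback.lift_fst _ _ _ _

lemma liftMappingPath_mpSnd (i : I) :
    (f.liftMappingPath r s h h').app i ≫ f.mpSnd i = s i :=
  IsPullback.lift_snd _ _ _ _

lemma liftMappingPath_snd (t : X ⟶ B)
    (ht : ∀ i, s i ≫ (D.K i).pr (D.deg i) (B.obj i) = t.app i) :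
    f.liftMappingPath r s h h' ≫ f.mappingPathSnd = t :=
  Diagram.hom_ext fun i => by
    rw [Diagram.comp_app, mappingPathSnd_app, ← Category.assoc, liftMappingPath_mpSnd, ht]

end

/-- The section of the first projection of a mapping path, given by the constant paths. -/
noncomputable def toMappingPath (f : HoHom A B) : HoHom A f.mappingPath :=
  ofPr (fun i => (f.isPullback_mp i).lift (𝟙 _) (f.app i ≫ (D.K i).const _) (by simp))
    -- The coproduct of `F_a` is a path of paths from the constant one to `F_a` itself, which is
    -- what joins the section at `j` to the comparison morphism `(φ_a, F_a)`.
    (fun {i j} a ha => (f.isPullback_map_mp j).lift (A.φ a ha ≫ (D.K j).const _)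
      (f.htpy a ha ≫ (D.K j).conn _) (by
        rw [Category.assoc, const_naturality, Category.assoc, conn_map_pr_zero, ← Category.assoc,
          ← Category.assoc, htpy_pr_zero]))
    (fun {i j} a ha => by
      refine (f.isPullback_mp j).hom_ext ?_ ?_
      · rw [Category.assoc, ← pr_naturality 0 (f.mpFst j), IsPullback.lift_fst_assoc, Category.assoc, const_pr,
          Category.assoc, IsPullback.lift_fst]
      · rw [Category.assoc, ← pr_naturality 0 (f.mpSnd j), IsPullback.lift_snd_assoc, Category.assoc,
          conn_pr_zero, Category.assoc, IsPullback.lift_snd]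
        simp only [← Category.assoc, htpy_pr_zero])
    (fun {i j} a ha => by
      rw [mappingPath_φ, ← Category.assoc ((D.push a).map _), ← (D.push a).map_comp,
        IsPullback.lift_fst, (D.push a).map_id, Category.id_comp]
      refine (f.isPullback_mp j).hom_ext ?_ ?_
      · rw [Category.assoc, ← pr_naturality 1 (f.mpFst j), IsPullback.lift_fst_assoc, edge_mpFst,
          Category.assoc, const_pr, Category.comp_id]
      · rw [Category.assoc, ← pr_naturality 1 (f.mpSnd j), IsPullback.lift_snd_assoc, edge_mpSnd,
          Category.assoc, conn_pr_one, Category.comp_id])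

section

variable (f : HoHom A B) (i : I) {j : I} (a : i ⟶ j) (ha : NonIdentity a)

@[simp] lemma toMappingPath_app_mpFst : f.toMappingPath.app i ≫ f.mpFst i = 𝟙 _ :=
  IsPullback.lift_fst _ _ _ _

@[simp] lemma toMappingPath_app_mpSnd :
    f.toMappingPath.app i ≫ f.mpSnd i = f.app i ≫ (D.K i).const _ :=
  IsPullback.lift_snd _ _ _ _

@[simp] lemma toMappingPath_htpy_mpFst :
    f.toMappingPath.htpy a ha ≫ (D.K j).P.map (f.mpFst j) = A.φ a ha ≫ (D.K j).const _ :=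
  IsPullback.lift_fst _ _ _ _

@[simp] lemma toMappingPath_htpy_mpSnd :
    f.toMappingPath.htpy a ha ≫ (D.K j).P.map (f.mpSnd j) = f.htpy a ha ≫ (D.K j).conn _ :=
  IsPullback.lift_snd _ _ _ _

end

lemma toMappingPath_comp_fst (f : HoHom A B) :
    f.toMappingPath.comp f.mappingPathFst = ofHom (𝟙 A) :=
  hoHom_ext (by simp) (by simp)

lemma toMappingPath_comp_snd (f : HoHom A B) : f.toMappingPath.comp f.mappingPathSnd = f := by
  refine hoHom_ext (fun i => ?_) fun i j a ha => ?_
  · rw [comp_app, mappingPathSnd_app, ← Category.assoc, toMappingPath_app_mpSnd, Category.assoc,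
      const_pr, Category.comp_id]
  -- Homotopies live only over vertices of degree 1, where `q_f` uses `δ 1`, and `P(δ 1)` recovers
  -- `F_a` from its coproduct.
  · have hj : D.deg j = 1 := by have := D.deg_lt a ha; omega
    rw [comp_htpy, mappingPathSnd_app, Functor.map_comp, ← Category.assoc,
      toMappingPath_htpy_mpSnd, hj, Category.assoc, conn_map_pr_one, Category.comp_id]

end HoHom

end CEDiagram

/-! ### The roof of a ho-morphism -/

namespace CEDiagram

variable {I : Type w} [SmallCategory I]

open PCategory Diagram

variable {D : DiagramData.{w, v, u} I}

namespace HoHom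

variable {A B X Y : Diagram D}

/-- A homotopy is spelled out as a path at each vertex and a square at each edge. The outer faces of
the square are the vertex paths, its inner faces the homotopies of `f` and `g`. -/
lemma homotopic_of_pr {f g : HoHom A B} (app : ∀ i : I, A.obj i ⟶ (D.K i).P.obj (B.obj i))
    (htpy : ∀ {i j : I} (a : i ⟶ j), NonIdentity a →
      ((D.push a).obj (A.obj i) ⟶ (D.K j).P.obj ((D.K j).P.obj (B.obj j))))
    (h₀ : ∀ {i j : I} (a : i ⟶ j) (ha : NonIdentity a),
      htpy a ha ≫ (D.K j).pr 0 ((D.K j).P.obj (B.obj j)) = A.φ a ha ≫ app j)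
    (h₁ : ∀ {i j : I} (a : i ⟶ j) (ha : NonIdentity a),
      htpy a ha ≫ (D.K j).pr 1 ((D.K j).P.obj (B.obj j)) =
        (D.push a).map (app i) ≫ D.swap a (B.obj i) ≫ (D.K j).P.map (B.φ a ha))
    (hf : ∀ i, app i ≫ (D.K i).pr 0 (B.obj i) = f.app i)
    (hg : ∀ i, app i ≫ (D.K i).pr 1 (B.obj i) = g.app i)
    (hf' : ∀ {i j : I} (a : i ⟶ j) (ha : NonIdentity a),
      htpy a ha ≫ (D.K j).P.map ((D.K j).pr 0 (B.obj j)) = f.htpy a ha)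
    (hg' : ∀ {i j : I} (a : i ⟶ j) (ha : NonIdentity a),
      htpy a ha ≫ (D.K j).P.map ((D.K j).pr 1 (B.obj j)) = g.htpy a ha) : Homotopic f g :=
  ⟨ofPr app htpy h₀ h₁, hoHom_ext hf fun _ _ a ha => hf' a ha,
    hoHom_ext hg fun _ _ a ha => hg' a ha⟩

/-! ### The first projection of a mapping path is a ho-equivalence -/

section

variable (f : HoHom A B) (i : I) {j : I} (a : i ⟶ j) (ha : NonIdentity a)

lemma toMappingPath_htpy_pr_one :
    f.toMappingPath.htpy a ha ≫ (D.K j).pr 1 _ = f.edge i a ha := by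
  rw [htpy_pr_one, mappingPath_φ, ← Category.assoc, ← (D.push a).map_comp,
    toMappingPath_app_mpFst, (D.push a).map_id, Category.id_comp]

/-- The contraction of the mapping path to the image of the section of its first projection. -/
noncomputable def contraction : f.mappingPath.obj i ⟶ (D.K i).P.obj (f.mappingPath.obj i) :=
  (f.isPullback_map_mp i).lift (f.mpFst i ≫ (D.K i).const _) (f.mpSnd i ≫ (D.K i).conn _) (by
    rw [Category.assoc, const_naturality, Category.assoc, conn_map_pr_zero, ← Category.assoc,
      ← Category.assoc, (f.isPullback_mp i).w])

@[simp] lemma contraction_mpFst :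
    f.contraction i ≫ (D.K i).P.map (f.mpFst i) = f.mpFst i ≫ (D.K i).const _ :=
  IsPullback.lift_fst _ _ _ _

@[simp] lemma contraction_mpSnd :
    f.contraction i ≫ (D.K i).P.map (f.mpSnd i) = f.mpSnd i ≫ (D.K i).conn _ :=
  IsPullback.lift_snd _ _ _ _

lemma edge_contraction : f.edge i a ha ≫ f.contraction j = f.toMappingPath.htpy a ha := by
  refine (f.isPullback_map_mp j).hom_ext ?_ ?_
  · rw [Category.assoc, contraction_mpFst, toMappingPath_htpy_mpFst, ← Category.assoc, edge_mpFst]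
  · rw [Category.assoc, contraction_mpSnd, toMappingPath_htpy_mpSnd, ← Category.assoc, edge_mpSnd]

lemma contraction_pr_zero :
    f.contraction i ≫ (D.K i).pr 0 _ = f.mpFst i ≫ f.toMappingPath.app i := by
  refine (f.isPullback_mp i).hom_ext ?_ ?_
  · rw [Category.assoc, ← pr_naturality 0 (f.mpFst i), ← Category.assoc, contraction_mpFst]
    simp
  · rw [Category.assoc, ← pr_naturality 0 (f.mpSnd i), ← Category.assoc, contraction_mpSnd,
      Category.assoc, Category.assoc, conn_pr_zero, toMappingPath_app_mpSnd, ← Category.assoc,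
      ← (f.isPullback_mp i).w, Category.assoc]

lemma contraction_pr_one : f.contraction i ≫ (D.K i).pr 1 _ = 𝟙 _ := by
  refine (f.isPullback_mp i).hom_ext ?_ ?_
  · rw [Category.assoc, ← pr_naturality 1 (f.mpFst i), ← Category.assoc, contraction_mpFst]
    simp
  · rw [Category.assoc, ← pr_naturality 1 (f.mpSnd i), ← Category.assoc, contraction_mpSnd]
    simp

end

lemma homotopic_toMappingPath_precomp (f : HoHom A B) :
    Homotopic (f.toMappingPath.precomp f.mappingPathFst) (ofHom (𝟙 f.mappingPath)) := by
  refine homotopic_of_pr f.contraction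
    -- The comparison morphism of the mapping path factors through the first projection, along which
    -- the contraction is constant. So the square needs a degenerate face at `δ 1`, which `conn'`
    -- supplies and `conn` would not.
    (fun {i j} a ha => (D.push a).map (f.mpFst i) ≫ f.toMappingPath.htpy a ha ≫ (D.K j).conn' _)
    (fun {i j} a ha => ?_) (fun {i j} a ha => ?_) (fun i => f.contraction_pr_zero i)
    (fun i => f.contraction_pr_one i) (fun {i j} a ha => ?_) fun {i j} a ha => ?_
  · rw [mappingPath_φ, Category.assoc, Category.assoc, Category.assoc, edge_contraction,
      conn'_pr_zero, Category.comp_id]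
  · have h : (D.push a).map (f.contraction i) ≫ D.swap a (f.mappingPath.obj i) ≫
        (D.K j).P.map ((D.push a).map (f.mpFst i)) =
        (D.push a).map (f.mpFst i) ≫ (D.K j).const _ := by
      rw [← D.swap_naturality, ← Category.assoc, ← (D.push a).map_comp, contraction_mpFst,
        (D.push a).map_comp, Category.assoc, D.const_swap]
    rw [mappingPath_φ, (D.K j).P.map_comp, reassoc_of% h, const_naturality, Category.assoc,
      Category.assoc, conn'_pr_one, ← Category.assoc (f.toMappingPath.htpy a ha),
      toMappingPath_htpy_pr_one]
  · rw [Category.assoc, Category.assoc, conn'_map_pr_zero, Category.comp_id]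
    rfl
  · rw [ofHom_htpy, Diagram.id_app, Category.assoc, Category.assoc, conn'_map_pr_one,
      ← Category.assoc (f.toMappingPath.htpy _ _), toMappingPath_htpy_pr_one, mappingPath_φ,
      Category.comp_id, Category.assoc]

lemma isHoEquiv_mappingPathFst (f : HoHom A B) : isHoEquiv D f.mappingPathFst :=
  ⟨f.toMappingPath, .rel _ _ f.homotopic_toMappingPath_precomp, by
    rw [toMappingPath_comp_fst]; exact .refl _⟩

/-- The coproduct is a homotopy from `ι δ 0` to the identity of the path. -/
lemma isHoEquiv_pathConst (B : Diagram D) : isHoEquiv D (pathConst B) := by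
  refine ⟨ofHom (pathδ 0 B), ?_, .rel _ _ ⟨ofHom (pathConn B), ?_, ?_⟩⟩
  · rw [precomp_ofHom, pathConst_pathδ]
    exact .refl _
  · rw [ofHom_comp, ofHom_comp, pathConn_pathδ_zero]
  · rw [ofHom_comp, pathConn_pathδ_one]

lemma isHoEquiv_of_isIso (f : A ⟶ B) [IsIso f] : isHoEquiv D f := by
  refine ⟨ofHom (inv f), ?_, ?_⟩
  · rw [precomp_ofHom, IsIso.hom_inv_id]
    exact .refl _
  · rw [ofHom_comp, IsIso.inv_hom_id]
    exact .refl _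

/-! ### The morphism of a localization given by a ho-morphism -/

section Roof

/-- A functor on diagrams that inverts the constant paths and the first projections of the mapping
paths. -/
structure InvertsPaths {E : Type*} [Category* E] (L : Diagram D ⥤ E) : Prop where
  fst : ∀ {A B : Diagram D} (f : HoHom A B), IsIso (L.map f.mappingPathFst)
  const : ∀ B : Diagram D, IsIso (L.map (pathConst B))

variable {E : Type*} [Category* E] {L : Diagram D ⥤ E} (hL : InvertsPaths L)
include hL

/-- The morphism `q_f ∘ p_f⁻¹` given by a ho-morphism `f`. -/
noncomputable def roof (f : HoHom A B) : L.obj A ⟶ L.obj B :=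
  have := hL.fst f
  inv (L.map f.mappingPathFst) ≫ L.map f.mappingPathSnd

lemma map_fst_roof (f : HoHom A B) : L.map f.mappingPathFst ≫ f.roof hL = L.map f.mappingPathSnd := by
  have := hL.fst f
  simp [roof]

lemma eq_roof (f : HoHom A B) (α : L.obj A ⟶ L.obj B)
    (h : L.map f.mappingPathFst ≫ α = L.map f.mappingPathSnd) : α = f.roof hL := by
  have := hL.fst f
  rw [← cancel_epi (L.map f.mappingPathFst), h, map_fst_roof]

/-- For a strict morphism the constant paths form a strict section of `p_f`, and `q_f` restricts to
`f` along it. -/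
lemma roof_ofHom (f : A ⟶ B) : (ofHom f).roof hL = L.map f := by
  have h₁ := (ofHom f).liftMappingPath_fst (𝟙 A) (fun i => f.app i ≫ (D.K i).const _)
    (by simp) (by simp)
  have h₂ := (ofHom f).liftMappingPath_snd (𝟙 A) (fun i => f.app i ≫ (D.K i).const _)
    (by simp) (by simp) f (by simp)
  have h := map_fst_roof hL (ofHom f)
  conv_rhs => rw [← h₂, L.map_comp, ← h, ← Category.assoc, ← L.map_comp, h₁, L.map_id,
    Category.id_comp]

lemma roof_comp (f : HoHom A B) (g : B ⟶ X) : (f.comp g).roof hL = f.roof hL ≫ L.map g := by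
  have hw (i : I) : f.mappingPathFst.app i ≫ (f.comp g).app i =
      (f.mpSnd i ≫ (D.K i).P.map (g.app i)) ≫ (D.K i).pr 0 _ := by
    rw [comp_app, mappingPathFst_app, ← Category.assoc, (f.isPullback_mp i).w]
    simp
  have hw' (i j : I) (a : i ⟶ j) (ha : NonIdentity a) :
      (D.push a).map (f.mappingPathFst.app i) ≫ (f.comp g).htpy a ha =
        f.mappingPath.φ a ha ≫ f.mpSnd j ≫ (D.K j).P.map (g.app j) := by
    rw [mappingPath_φ, mappingPathFst_app, comp_htpy, Category.assoc,
      ← Category.assoc (f.edge i a ha), edge_mpSnd]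
  have h₁ := (f.comp g).liftMappingPath_fst f.mappingPathFst _ hw hw'
  have h₂ := (f.comp g).liftMappingPath_snd f.mappingPathFst _ hw hw'
    (f.mappingPathSnd ≫ g) (by simp)
  have := hL.fst f
  rw [← cancel_epi (L.map f.mappingPathFst), ← Category.assoc, map_fst_roof, ← L.map_comp, ← h₂,
    L.map_comp, ← map_fst_roof hL, ← Category.assoc, ← L.map_comp, h₁]

lemma roof_precomp (g : A ⟶ B) (f : HoHom B X) :
    (f.precomp g).roof hL = L.map g ≫ f.roof hL := by
  have hw (i : I) : ((f.precomp g).mappingPathFst ≫ g).app i ≫ f.app i =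
      (f.precomp g).mpSnd i ≫ (D.K i).pr 0 _ := by
    rw [← ((f.precomp g).isPullback_mp i).w]
    simp
  have hw' (i j : I) (a : i ⟶ j) (ha : NonIdentity a) :
      (D.push a).map (((f.precomp g).mappingPathFst ≫ g).app i) ≫ f.htpy a ha =
        (f.precomp g).mappingPath.φ a ha ≫ (f.precomp g).mpSnd j := by
    rw [mappingPath_φ, Diagram.comp_app, mappingPathFst_app, (D.push a).map_comp, Category.assoc,
      Category.assoc, edge_mpSnd, precomp_htpy]
  have h₁ := f.liftMappingPath_fst ((f.precomp g).mappingPathFst ≫ g) _ hw hw'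
  have h₂ := f.liftMappingPath_snd ((f.precomp g).mappingPathFst ≫ g) _ hw hw'
    (f.precomp g).mappingPathSnd (by simp)
  refine (eq_roof hL _ _ ?_).symm
  rw [← Category.assoc, ← L.map_comp, ← h₁, L.map_comp, Category.assoc, map_fst_roof,
    ← L.map_comp, h₂]

/-- Both `L(δ 0)` and `L(δ 1)` are inverse to the image of the constant path, hence equal. -/
lemma roof_eq_of_homotopic {f g : HoHom A B} (h : Homotopic f g) : f.roof hL = g.roof hL := by
  obtain ⟨h, rfl, rfl⟩ := h
  have := hL.const B
  rw [roof_comp, roof_comp]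
  congr 1
  rw [← cancel_epi (L.map (pathConst B)), ← L.map_comp, ← L.map_comp, pathConst_pathδ,
    pathConst_pathδ]

end Roof

end HoHom

end CEDiagram

/-! ### Composites, and the invariance of homotopy classes under weak equivalences -/

namespace CEDiagram

variable {I : Type w} [SmallCategory I]

open PCategory Diagram

variable {D : DiagramData.{w, v, u} I}

/-! ### Composites of ho-morphisms -/

namespace PCategory

variable {C : Type u} [Category.{v} C] (K : PCategory C)

/-- The endomorphism of the path that is the constant path at the initial point for `k = 0` and
the identity for `k = 1`. -/
def collapse (k : Fin 2) (A : C) : K.P.obj A ⟶ K.P.obj A :=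
  if k = 0 then K.pr 0 A ≫ K.const A else 𝟙 _

variable {K}

lemma collapse_zero (A : C) : K.collapse 0 A = K.pr 0 A ≫ K.const A := if_pos rfl

lemma collapse_one (A : C) : K.collapse 1 A = 𝟙 _ := if_neg (by decide)

lemma collapse_pr_zero (k : Fin 2) (A : C) : K.collapse k A ≫ K.pr 0 A = K.pr 0 A := by
  fin_cases k
  · simp [collapse_zero]
  · simp [collapse_one]

lemma collapse_pr_one (k : Fin 2) (A : C) : K.collapse k A ≫ K.pr 1 A = K.pr k A := by
  fin_cases k
  · simp [collapse_zero]
  · simp [collapse_one]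

end PCategory

lemma DiagramData.deg_source (D : DiagramData.{w, v, u} I) {i j : I} (a : i ⟶ j)
    (ha : NonIdentity a) : D.deg i = 0 := by
  have := D.deg_lt a ha
  omega

lemma DiagramData.deg_target (D : DiagramData.{w, v, u} I) {i j : I} (a : i ⟶ j)
    (ha : NonIdentity a) : D.deg j = 1 := by
  have := D.deg_lt a ha
  omega

/-- The images of the vertices of a diagram under the transition functors are cofibrant. -/
def Diagram.PushCofibrant (A : Diagram D) : Prop :=
  ∀ {i j : I} (a : i ⟶ j), (D.K j).Cofibrant ((D.push a).obj (A.obj i))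

namespace HoHom

variable {A B X Y : Diagram D}

lemma exists_isComposite (hA : A.PushCofibrant) (f : HoHom A B) (g : HoHom B X) :
    ∃ k : HoHom A X, f.IsComposite g k := by
  have h (i j : I) (a : i ⟶ j) (ha : NonIdentity a) :
      ∃ l : (D.push a).obj (A.obj i) ⟶ (D.K j).P.obj ((D.K j).P.obj (X.obj j)),
        l ≫ (D.K j).pr 0 _ = f.htpy a ha ≫ (D.K j).P.map (g.app j) ∧
        l ≫ (D.K j).P.map ((D.K j).pr 1 _) = (D.push a).map (f.app i) ≫ g.htpy a ha := by
    have h₀ : (f.htpy a ha ≫ (D.K j).P.map (g.app j)) ≫ (D.K j).pr 1 (X.obj j) =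
        ((D.push a).map (f.app i) ≫ g.htpy a ha) ≫ (D.K j).pr 0 (X.obj j) := by
      rw [Category.assoc, Category.assoc, pr_naturality, htpy_pr_zero, ← Category.assoc,
        ← Category.assoc, htpy_pr_one]
    -- The filler is a lift of the path `G_a ∘ f i` along the trivial fibration `δ 1`. Its initial
    -- point is `P(g j) ∘ F_a`, and cofibrancy provides some final point `x`.
    obtain ⟨x, hx⟩ := hA a ((D.K j).pr 1 (X.obj j))
      (((D.push a).map (f.app i) ≫ g.htpy a ha) ≫ (D.K j).pr 1 (X.obj j)) (fib_pr _ _) (weq_pr _ _)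
    obtain ⟨s, h₁, -, h₂⟩ := (hA a).exists_path_lift (fib_pr 1 (X.obj j)) (weq_pr 1 (X.obj j))
      (f.htpy a ha ≫ (D.K j).P.map (g.app j)) x _ h₀ hx
    exact ⟨s, h₁, h₂⟩
  choose l hl hl' using h
  refine ⟨ofPr (fun i => f.app i ≫ g.app i) (fun {i j} a ha => l i j a ha ≫ (D.K j).nabla _)
    (fun {i j} a ha => ?_) (fun {i j} a ha => ?_), fun i => rfl, fun {i j} a ha =>
      ⟨l i j a ha, hl i j a ha, hl' i j a ha, rfl⟩⟩
  · rw [Category.assoc, nabla_pr, ← Category.assoc, hl, Category.assoc, pr_naturality,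
      ← Category.assoc, htpy_pr_zero, Category.assoc]
  · rw [Category.assoc, nabla_pr, ← pr_naturality, ← Category.assoc, hl', Category.assoc,
      htpy_pr_one, (D.push a).map_comp, Category.assoc]

/-- This avoids comparing `k` with `g` and `f` directly: over the mapping path of `f`, the
ho-morphism `f` is replaced by the strict `q_f`. At a vertex, the homotopy moves along the image
under `g` of the path stored in the mapping path. -/
lemma IsComposite.homotopic (hA : A.PushCofibrant) {f : HoHom A B} {g : HoHom B X}
    {k : HoHom A X} (hk : f.IsComposite g k) :
    Homotopic (k.precomp f.mappingPathFst) (g.precomp f.mappingPathSnd) := by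
  have h (i j : I) (a : i ⟶ j) (ha : NonIdentity a) :
      ∃ s : (D.push a).obj (A.obj i) ⟶ (D.K j).P.obj ((D.K j).P.obj (X.obj j)),
        s ≫ (D.K j).pr 0 _ = f.htpy a ha ≫ (D.K j).P.map (g.app j) ∧
        s ≫ (D.K j).pr 1 _ =
          ((D.push a).map (f.app i ≫ g.app i) ≫ X.φ a ha) ≫ (D.K j).const _ ∧
        s ≫ (D.K j).P.map ((D.K j).pr 0 _) = k.htpy a ha ∧
        s ≫ (D.K j).P.map ((D.K j).pr 1 _) = (D.push a).map (f.app i) ≫ g.htpy a ha := by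
    obtain ⟨l, h₀, h₁, h₂⟩ := hk.2 a ha
    change l ≫ (D.K j).pr 0 _ = _ at h₀
    change l ≫ (D.K j).P.map ((D.K j).pr 1 _) = _ at h₁
    change _ = l ≫ (D.K j).nabla _ at h₂
    obtain ⟨s, hs₀, hs₁, hs₂, hs₃⟩ := (hA a).exists_fold_square l
    refine ⟨s, hs₀.trans h₀, hs₁.trans ?_, hs₂.trans h₂.symm, hs₃.trans h₁⟩
    rw [← pr_naturality_assoc, ← Category.assoc, h₁, Category.assoc,
      ← Category.assoc (g.htpy a ha), htpy_pr_one, (D.push a).map_comp]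
    simp only [Category.assoc]
  choose s hs₀ hs₁ hs₂ hs₃ using h
  refine homotopic_of_pr
    -- In degree 0 the map `q_f` ends at the initial point of the path, so the homotopy must be
    -- constant there; this matches the degenerate side of the square `s`.
    (fun i => f.mpSnd i ≫ (D.K i).P.map (g.app i) ≫ (D.K i).collapse (D.deg i) _)
    (fun {i j} a ha => (D.push a).map (f.mpFst i) ≫ s i j a ha)
    (fun {i j} a ha => ?_) (fun {i j} a ha => ?_) (fun i => ?_) (fun i => ?_)
    (fun {i j} a ha => ?_) (fun {i j} a ha => ?_)
  · rw [D.deg_target a ha, collapse_one, Category.comp_id, Category.assoc, hs₀, mappingPath_φ,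
      Category.assoc, ← Category.assoc (f.edge i a ha), edge_mpSnd]
  · rw [D.deg_source a ha, collapse_zero, pr_naturality_assoc, ← Category.assoc (f.mpSnd i),
      ← (f.isPullback_mp i).w, Category.assoc, hs₁]
    simp only [(D.push a).map_comp, Category.assoc]
    rw [← Category.assoc _ (D.swap a _), D.const_swap, const_naturality]
  · rw [Category.assoc, Category.assoc, collapse_pr_zero, pr_naturality, ← Category.assoc,
      ← (f.isPullback_mp i).w, precomp_app, hk.1, mappingPathFst_app, Category.assoc]
  · rw [Category.assoc, Category.assoc, collapse_pr_one, pr_naturality, precomp_app,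
      mappingPathSnd_app, Category.assoc]
  · rw [Category.assoc, hs₂, precomp_htpy, mappingPathFst_app]
  · rw [Category.assoc, hs₃, precomp_htpy, mappingPathSnd_app, D.deg_source a ha,
      ← (f.isPullback_mp i).w, (D.push a).map_comp, Category.assoc]

lemma IsComposite.roof_eq (hA : A.PushCofibrant) {f : HoHom A B} {g : HoHom B X}
    {k : HoHom A X} (hk : f.IsComposite g k) {E : Type*} [Category* E] {L : Diagram D ⥤ E}
    (hL : InvertsPaths L) : f.roof hL ≫ g.roof hL = k.roof hL := by
  have := hL.fst f
  rw [← cancel_epi (L.map f.mappingPathFst), ← roof_precomp,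
    roof_eq_of_homotopic hL (hk.homotopic hA),
    roof_precomp, ← Category.assoc, map_fst_roof]

end HoHom

/-! ### Lifting of ho-morphisms along weak equivalences -/

namespace Diagram

/-- The conditions on a diagram that allow to lift ho-morphisms to it. -/
structure IsCofibrant (M : Diagram D) : Prop where
  cof : Diagram.cof D M
  push : M.PushCofibrant

variable {A B M X : Diagram D}

/-- Level-wise trivial fibrations. -/
def TrivFib (p : A ⟶ B) : Prop := ∀ i, (D.K i).fib (p.app i) ∧ (D.K i).weq (p.app i)

lemma IsCofibrant.exists_lift (hM : M.IsCofibrant) {p : A ⟶ B} (hp : TrivFib p)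
    (f : HoHom M B) : ∃ g : HoHom M A, g.comp p = f := by
  choose g hg using fun i => hM.cof i (p.app i) (f.app i) (hp i).1 (hp i).2
  have h (i j : I) (a : i ⟶ j) (ha : NonIdentity a) :
      ∃ s : (D.push a).obj (M.obj i) ⟶ (D.K j).P.obj (A.obj j),
        s ≫ (D.K j).pr 0 _ = M.φ a ha ≫ g j ∧
        s ≫ (D.K j).pr 1 _ = (D.push a).map (g i) ≫ A.φ a ha ∧
        s ≫ (D.K j).P.map (p.app j) = f.htpy a ha := by
    refine (hM.push a).exists_path_lift (hp j).1 (hp j).2 _ _ _ ?_ ?_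
    · rw [HoHom.htpy_pr_zero, Category.assoc, hg]
    · rw [HoHom.htpy_pr_one, Category.assoc, ← comm, ← Category.assoc, ← (D.push a).map_comp, hg]
  choose s hs₀ hs₁ hs using h
  exact ⟨HoHom.ofPr g (fun {i j} a ha => s i j a ha) (fun {i j} a ha => hs₀ i j a ha)
    (fun {i j} a ha => hs₁ i j a ha), HoHom.hoHom_ext hg hs⟩

/-- The vertex paths are lifted first. Together with the homotopies of `f` and `g` they prescribe
the four sides of the squares to be lifted at the edges. -/
lemma IsCofibrant.homotopic_of_comp (hM : M.IsCofibrant) {p : A ⟶ B} (hp : TrivFib p)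
    {f g : HoHom M A} (h : HoHom.Homotopic (f.comp p) (g.comp p)) : HoHom.Homotopic f g := by
  obtain ⟨h, hf, hg⟩ := h
  have hf₀ (i) : h.app i ≫ (D.K i).pr 0 _ = f.app i ≫ p.app i :=
    congrArg (fun k => HoHom.app k i) hf
  have hg₀ (i) : h.app i ≫ (D.K i).pr 1 _ = g.app i ≫ p.app i :=
    congrArg (fun k => HoHom.app k i) hg
  have hf₁ {i j : I} (a : i ⟶ j) (ha : NonIdentity a) :
      h.htpy a ha ≫ (D.K j).P.map ((D.K j).pr 0 _) = f.htpy a ha ≫ (D.K j).P.map (p.app j) :=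
    congrArg (fun k => HoHom.htpy k a ha) hf
  have hg₁ {i j : I} (a : i ⟶ j) (ha : NonIdentity a) :
      h.htpy a ha ≫ (D.K j).P.map ((D.K j).pr 1 _) = g.htpy a ha ≫ (D.K j).P.map (p.app j) :=
    congrArg (fun k => HoHom.htpy k a ha) hg
  have h₀ {i j : I} (a : i ⟶ j) (ha : NonIdentity a) :
      h.htpy a ha ≫ (D.K j).pr 0 ((D.K j).P.obj (B.obj j)) = M.φ a ha ≫ h.app j :=
    h.htpy_pr_zero i a ha
  have h₁ {i j : I} (a : i ⟶ j) (ha : NonIdentity a) :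
      h.htpy a ha ≫ (D.K j).pr 1 ((D.K j).P.obj (B.obj j)) =
        (D.push a).map (h.app i) ≫ D.swap a (B.obj i) ≫ (D.K j).P.map (B.φ a ha) :=
    h.htpy_pr_one i a ha
  choose t ht₀ ht₁ ht using fun i => (hM.cof i).exists_path_lift (hp i).1 (hp i).2 (f.app i)
    (g.app i) (h.app i) (hf₀ i).symm (hg₀ i).symm
  have key (i j : I) (a : i ⟶ j) (ha : NonIdentity a) :
      ∃ s : (D.push a).obj (M.obj i) ⟶ (D.K j).P.obj ((D.K j).P.obj (A.obj j)),
        s ≫ (D.K j).pr 0 _ = M.φ a ha ≫ t j ∧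
        s ≫ (D.K j).pr 1 _ = (D.push a).map (t i) ≫ D.swap a _ ≫ (D.K j).P.map (A.φ a ha) ∧
        s ≫ (D.K j).P.map ((D.K j).pr 0 _) = f.htpy a ha ∧
        s ≫ (D.K j).P.map ((D.K j).pr 1 _) = g.htpy a ha ∧
        s ≫ (D.K j).P.map ((D.K j).P.map (p.app j)) = h.htpy a ha := by
    have hsw (k : Fin 2) : ((D.push a).map (t i) ≫ D.swap a _ ≫ (D.K j).P.map (A.φ a ha)) ≫
        (D.K j).pr k _ = (D.push a).map (t i ≫ (D.K i).pr k _) ≫ A.φ a ha := by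
      rw [Category.assoc, Category.assoc, pr_naturality, ← Category.assoc (D.swap a _),
        D.swap_pr, (D.push a).map_comp, Category.assoc]
    refine (hM.push a).exists_square_lift (hp j).1 (hp j).2 _ _ _ _ _ ?_ ?_ ?_ ?_ ?_ ?_ ?_ ?_
    · rw [Category.assoc, ht₀, HoHom.htpy_pr_zero]
    · rw [Category.assoc, ht₁, HoHom.htpy_pr_zero]
    · rw [hsw, ht₀, HoHom.htpy_pr_one]
    · rw [hsw, ht₁, HoHom.htpy_pr_one]
    · rw [Category.assoc, ht]
      exact (h₀ a ha).symm
    · rw [Category.assoc, Category.assoc, ← (D.K j).P.map_comp, ← comm, (D.K j).P.map_comp,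
        ← Category.assoc (D.swap a _), ← D.swap_naturality, Category.assoc, ← Category.assoc,
        ← (D.push a).map_comp, ht]
      exact (h₁ a ha).symm
    · exact (hf₁ a ha).symm
    · exact (hg₁ a ha).symm
  choose s hs₀ hs₁ hs₂ hs₃ _ using key
  exact HoHom.homotopic_of_pr t (fun {i j} a ha => s i j a ha) (fun {i j} a ha => hs₀ i j a ha)
    (fun {i j} a ha => hs₁ i j a ha) ht₀ ht₁ (fun {i j} a ha => hs₂ i j a ha)
    (fun {i j} a ha => hs₃ i j a ha)

/-- A level-wise weak equivalence is a section of a level-wise trivial fibration followed by a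
level-wise trivial fibration. -/
lemma exists_factorization (f : A ⟶ B) (hf : weq D f) :
    ∃ (N : Diagram D) (s : A ⟶ N) (p : N ⟶ A) (q : N ⟶ B), s ≫ p = 𝟙 A ∧ s ≫ q = f ∧
      TrivFib p ∧ TrivFib q := by
  have h (i : I) : ∃ (N : D.F.obj i) (p : N ⟶ A.obj i) (q : N ⟶ (D.K i).P.obj (B.obj i)),
      IsPullback p q (f.app i) ((D.K i).pr 0 (B.obj i)) := by
    have := (D.K i).hasPullback (f.app i) ((D.K i).pr 0 (B.obj i)) (fib_pr _ _)
    exact ⟨_, _, _, IsPullback.of_hasPullback _ _⟩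
  choose N p q hN using h
  have hw {i j : I} (a : i ⟶ j) (ha : NonIdentity a) :
      ((D.push a).map (p i) ≫ A.φ a ha) ≫ f.app j =
        ((D.push a).map (q i) ≫ D.swap a _ ≫ (D.K j).P.map (B.φ a ha)) ≫ (D.K j).pr 0 _ := by
    rw [Category.assoc, ← comm, ← Category.assoc, ← (D.push a).map_comp, (hN i).w,
      Category.assoc, Category.assoc, pr_naturality, ← Category.assoc (D.swap a _), D.swap_pr,
      (D.push a).map_comp, Category.assoc]
  -- Unlike in `mappingPath`, the comparison morphisms also transport the stored path, so `δ 1`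
  -- after the second projection is a strict morphism in every degree.
  let Z : Diagram D := ⟨N, fun {i j} a ha => (hN j).lift _ _ (hw a ha)⟩
  have hZ₁ {i j : I} (a : i ⟶ j) (ha : NonIdentity a) :
      Z.φ a ha ≫ p j = (D.push a).map (p i) ≫ A.φ a ha := (hN j).lift_fst _ _ _
  have hZ₂ {i j : I} (a : i ⟶ j) (ha : NonIdentity a) :
      Z.φ a ha ≫ q j = (D.push a).map (q i) ≫ D.swap a _ ≫ (D.K j).P.map (B.φ a ha) :=
    (hN j).lift_snd _ _ _
  let s (i : I) : A.obj i ⟶ N i := (hN i).lift (𝟙 _) (f.app i ≫ (D.K i).const _) (by simp)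
  have hs₁ (i : I) : s i ≫ p i = 𝟙 _ := (hN i).lift_fst _ _ _
  have hs₂ (i : I) : s i ≫ q i = f.app i ≫ (D.K i).const _ := (hN i).lift_snd _ _ _
  have hs {i j : I} (a : i ⟶ j) (ha : NonIdentity a) :
      (D.push a).map (s i) ≫ Z.φ a ha = A.φ a ha ≫ s j := by
    refine (hN j).hom_ext ?_ ?_
    · rw [Category.assoc, hZ₁, ← Category.assoc, ← (D.push a).map_comp, hs₁, Category.assoc, hs₁,
        (D.push a).map_id, Category.id_comp, Category.comp_id]
    · rw [Category.assoc, hZ₂, ← Category.assoc, ← (D.push a).map_comp, hs₂, Category.assoc, hs₂,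
        (D.push a).map_comp, Category.assoc, ← Category.assoc _ (D.swap a _), D.const_swap,
        const_naturality, ← Category.assoc, comm, Category.assoc]
  refine ⟨Z, ⟨s, hs⟩, ⟨p, fun a ha => (hZ₁ a ha).symm⟩, ⟨fun i => q i ≫ (D.K i).pr 1 _,
    fun {i j} a ha => ?_⟩, hom_ext hs₁, hom_ext fun i => ?_,
    fun i => ⟨(D.K i).fib_pullback (hN i) (fib_pr _ _),
      (D.K i).weq_pullback (hN i) (fib_pr _ _) (weq_pr _ _)⟩,
    fun i => ⟨fib_mappingPath (hN i), weq_mappingPath (hN i) (hf i) 1⟩⟩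
  · rw [← Category.assoc (Z.φ a ha), hZ₂, (D.push a).map_comp, ← D.swap_pr, Category.assoc,
      Category.assoc, Category.assoc, Category.assoc, pr_naturality]
  · change s i ≫ q i ≫ (D.K i).pr 1 _ = f.app i
    rw [← Category.assoc, hs₂, Category.assoc, const_pr, Category.comp_id]

end Diagram

/-- The map on homotopy classes of ho-morphisms given by a morphism. -/
def HoClass.map {A B X : Diagram D} (g : B ⟶ X) : HoClass A B → HoClass A X :=
  Quot.map (fun f => f.comp g) fun _ _ h => h.comp g

namespace Diagram

variable {A B M X : Diagram D}

lemma hoClass_map_comp (f : A ⟶ B) (g : B ⟶ X) (x : HoClass M A) :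
    HoClass.map (f ≫ g) x = HoClass.map g (HoClass.map f x) := by
  induction x using Quot.ind with | _ x => exact congrArg HoHom.cls (x.comp_comp f g).symm

lemma hoClass_map_id (x : HoClass M A) : HoClass.map (𝟙 A) x = x := by
  induction x using Quot.ind with | _ x => exact congrArg HoHom.cls x.comp_id

lemma IsCofibrant.bijective_map_of_trivFib (hM : M.IsCofibrant) {p : A ⟶ B} (hp : TrivFib p) :
    Function.Bijective (HoClass.map (A := M) p) := by
  choose r hr using fun f => hM.exists_lift hp f
  let R : HoClass M B → HoClass M A := Quot.map r fun f g h => by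
    refine hM.homotopic_of_comp hp ?_
    rwa [hr, hr]
  have h₁ : Function.LeftInverse R (HoClass.map p) := fun x => by
    induction x using Quot.ind with
    | _ x =>
      refine Quot.sound (hM.homotopic_of_comp hp ?_)
      rw [hr]
      exact .refl _
  have h₂ : Function.RightInverse R (HoClass.map p) := fun x => by
    induction x using Quot.ind with | _ x => exact congrArg HoHom.cls (hr x)
  exact ⟨h₁.injective, h₂.surjective⟩

/-- In the factorization, the section of a trivial fibration acts bijectively because its retraction
does. -/
lemma IsCofibrant.bijective_map (hM : M.IsCofibrant) {f : A ⟶ B} (hf : weq D f) :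
    Function.Bijective (HoClass.map (A := M) f) := by
  obtain ⟨N, s, p, q, h₁, rfl, hp, hq⟩ := exists_factorization f hf
  have hp' := hM.bijective_map_of_trivFib hp
  have hs : Function.Bijective (HoClass.map (A := M) s) := by
    refine (Function.Bijective.of_comp_iff' hp' _).1 ?_
    convert Function.bijective_id
    funext x
    rw [Function.comp_apply, ← hoClass_map_comp, h₁, hoClass_map_id, id]
  convert (hM.bijective_map_of_trivFib hq).comp hs
  funext x
  rw [Function.comp_apply, hoClass_map_comp]

end Diagram

end CEDiagram

/-! ### Representability in the localizations, and the homotopy category -/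

namespace CEDiagram

/-! ### Representability over a localization -/

section Localization

universe t

lemma lift_map_Q {C E : Type*} [Category* C] [Category* E] {W : MorphismProperty C} (F : C ⥤ E)
    (hF : W.IsInvertedBy F) {A B : C} (f : A ⟶ B) :
    (Localization.Construction.lift F hF).map (W.Q.map f) = F.map f :=
  (Functor.congr_hom (Localization.Construction.fac F hF) f).trans
    ((Category.id_comp _).trans (Category.comp_id _))

variable {C : Type u} [Category.{v} C] {W : MorphismProperty C} {F : C ⥤ Type t}
  (hF : W.IsInvertedBy F) {M : C} (x₀ : F.obj M)
  (Φ : ∀ B : C, F.obj B → (W.Q.obj M ⟶ W.Q.obj B))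

lemma lift_map_Q_apply {A B : C} (f : A ⟶ B) (x : F.obj A) :
    (Localization.Construction.lift F hF).map (W.Q.map f) x = F.map f x :=
  congrArg (fun g : F.obj A ⟶ F.obj B => g x) (lift_map_Q F hF f)

-- The morphisms for which the naturality square commutes are closed under composition and under
-- inverses of the inverted maps, and contain the images of morphisms of `C`; these generate the
-- localization.
include hF in
lemma naturality_of_localization
    (hΦ : ∀ {A B : C} (f : A ⟶ B) (x : F.obj A), Φ B (F.map f x) = Φ A x ≫ W.Q.map f)
    {A B : C} (α : W.Q.obj A ⟶ W.Q.obj B) (x : F.obj A) :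
    Φ B ((Localization.Construction.lift F hF).map α x) = Φ A x ≫ α := by
  let P : MorphismProperty W.Localization := fun X Y β =>
    ∀ x : F.obj X.as.obj, Φ Y.as.obj ((Localization.Construction.lift F hF).map β x) =
      (Φ X.as.obj x ≫ β :)
  have : P.IsStableUnderComposition := ⟨fun {X Y Z} f g hf hg x => by
    have h : (Localization.Construction.lift F hF).map (f ≫ g) x =
      (Localization.Construction.lift F hF).map g ((Localization.Construction.lift F hF).map f x) := by
      rw [Functor.map_comp]; rfl
    rw [h]
    exact (hg _).trans ((congrArg (· ≫ g) (hf x)).trans (Category.assoc _ _ _))⟩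
  have h : P = ⊤ := by
    refine Localization.Construction.morphismProperty_eq_top' P (fun X Y f x => ?_)
      fun X Y e he x => ?_
    · exact (congrArg (Φ Y) (lift_map_Q_apply hF f x)).trans (hΦ f x)
    · have h₁ := he ((Localization.Construction.lift F hF).map e.inv x)
      have h₂ : (Localization.Construction.lift F hF).map e.hom
          ((Localization.Construction.lift F hF).map e.inv x) = x := by
        have := congrArg (fun g => g x) ((Localization.Construction.lift F hF).mapIso e).inv_hom_id
        exact this
      rw [h₂] at h₁
      exact ((Iso.comp_inv_eq e).2 h₁).symm
  have h' : P α := by rw [h]; trivial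
  exact h' x

include hF in
/-- A family of maps to the morphisms of the localization is bijective if it is natural and every
element is obtained from a universal one through a roof. -/
lemma bijective_of_localization
    (hΦ : ∀ {A B : C} (f : A ⟶ B) (x : F.obj A), Φ B (F.map f x) = Φ A x ≫ W.Q.map f)
    (h₀ : Φ M x₀ = 𝟙 _)
    (hr : ∀ (B : C) (x : F.obj B), ∃ (N : C) (p : N ⟶ M) (q : N ⟶ B) (y : F.obj N),
      IsIso (W.Q.map p) ∧ F.map p y = x₀ ∧ F.map q y = x) (B : C) :
    Function.Bijective (Φ B) := by
  -- Evaluation at `x₀` is the inverse. If `x₀` and `x` are the images of `y` under `p` and `q`,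
  -- then `Φ y` is inverse to `Q(p)`, so `Φ x` is the roof `q p⁻¹`, which carries `x₀` to `y` and
  -- then to `x`.
  have key (x : F.obj B) : (Localization.Construction.lift F hF).map (Φ B x) x₀ = x := by
    obtain ⟨N, p, q, y, hp, rfl, rfl⟩ := hr B x
    have e : inv (W.Q.map p) = Φ N y :=
      IsIso.inv_eq_of_inv_hom_id (by rw [← hΦ, h₀])
    have h : (Localization.Construction.lift F hF).map (inv (W.Q.map p)) (F.map p y) = y := by
      rw [← lift_map_Q_apply hF p y]
      have := congrArg (fun g => g y) ((Localization.Construction.lift F hF).mapIso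
        (asIso (W.Q.map p))).hom_inv_id
      exact this
    rw [hΦ, ← e, Functor.map_comp]
    refine Eq.trans ?_ (lift_map_Q_apply hF q y)
    exact congrArg ((Localization.Construction.lift F hF).map (W.Q.map q)) h
  refine ⟨fun x x' h => ?_, fun α => ⟨(Localization.Construction.lift F hF).map α x₀, ?_⟩⟩
  · rw [← key x, ← key x', h]
  · rw [naturality_of_localization hF Φ hΦ α x₀, h₀, Category.id_comp]

end Localization

variable {I : Type w} [SmallCategory I]

open PCategory Diagram

variable {D : DiagramData.{w, v, u} I}

/-! ### Strong and weak equivalences of diagrams -/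

namespace Diagram

lemma weq_of_isIso {A B : Diagram D} (f : A ⟶ B) [IsIso f] : weq D f := fun i =>
  (D.K i).weq_of_isIso _ ⟨(inv f).app i, by rw [← comp_app, IsIso.hom_inv_id]; rfl, by
    rw [← comp_app, IsIso.inv_hom_id]; rfl⟩

lemma weq_mappingPathFst {A B : Diagram D} (f : HoHom A B) : weq D f.mappingPathFst := fun i =>
  (D.K i).weq_pullback (f.isPullback_mp i) (fib_pr _ _) (weq_pr _ _)

lemma weq_mappingPathSnd {A B : Diagram D} (f : HoHom A B) (hf : ∀ i, (D.K i).weq (f.app i)) :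
    weq D f.mappingPathSnd := fun i =>
  weq_mappingPath (f.isPullback_mp i) (hf i) _

end Diagram

variable (D)

lemma invertsPaths_weq : HoHom.InvertsPaths (weq D).Q where
  fst f := (weq D).Q_inverts _ (weq_mappingPathFst f)
  const B := (weq D).Q_inverts _ fun i => (D.K i).weq_ι (B.obj i)

lemma invertsPaths_hoEquiv : HoHom.InvertsPaths (hoEquiv D).Q where
  fst f := (hoEquiv D).Q_inverts _ (.of _ f.isHoEquiv_mappingPathFst)
  const B := (hoEquiv D).Q_inverts _ (.of _ (HoHom.isHoEquiv_pathConst B))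

lemma roof_eq_of_eqvGen {A B : Diagram D} {E : Type*} [Category* E] {L : Diagram D ⥤ E}
    (hL : HoHom.InvertsPaths L) {f g : HoHom A B} (h : Relation.EqvGen HoHom.Homotopic f g) :
    f.roof hL = g.roof hL := by
  induction h with
  | rel _ _ h => exact HoHom.roof_eq_of_homotopic hL h
  | refl => rfl
  | symm _ _ _ h => exact h.symm
  | trans _ _ _ _ _ h h' => exact h.trans h'

/-- The roof of the ho-inverse is the inverse, since roofs are compatible with strict composition
and with homotopy. -/
lemma isInvertedBy_isHoEquiv {E : Type*} [Category* E] {L : Diagram D ⥤ E}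
    (hL : HoHom.InvertsPaths L) : (isHoEquiv D).IsInvertedBy L := by
  rintro A B f ⟨g, h₁, h₂⟩
  refine ⟨g.roof hL, ?_, ?_⟩
  · rw [← HoHom.roof_precomp, roof_eq_of_eqvGen D hL h₁, HoHom.roof_ofHom, L.map_id]
  · rw [← HoHom.roof_comp, roof_eq_of_eqvGen D hL h₂, HoHom.roof_ofHom, L.map_id]

lemma isInvertedBy_hoEquiv {E : Type*} [Category* E] {L : Diagram D ⥤ E}
    (hL : HoHom.InvertsPaths L) : (hoEquiv D).IsInvertedBy L := by
  intro A B f hf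
  induction hf with
  | of f hf => exact isInvertedBy_isHoEquiv D hL f hf
  | id => rw [L.map_id]; infer_instance
  | comp_of f g _ hg h =>
    have := isInvertedBy_isHoEquiv D hL g hg
    rw [L.map_comp]; infer_instance

lemma isStrongWeak : IsStrongWeak (hoEquiv D) (weq D) where
  strong_of_isIso f _ := .of _ (HoHom.isHoEquiv_of_isIso f)
  strong_comp f g hf hg := (isHoEquiv D).multiplicativeClosure.comp_mem f g hf hg
  weak_of_isIso f _ := weq_of_isIso f
  weak_comp _ _ hf hg i := weq_comp (hf i) (hg i)
  strong_le := isInvertedBy_hoEquiv D (invertsPaths_weq D)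

variable {D}

/-! ### Morphisms from a cofibrant diagram -/

/-- The functor of the homotopy classes of ho-morphisms from a diagram. -/
def hoFunctor (M : Diagram D) : Diagram D ⥤ Type _ where
  obj A := HoClass M A
  map f := TypeCat.ofHom (HoClass.map f)
  map_id A := by ext x; exact hoClass_map_id x
  map_comp f g := by ext x; exact hoClass_map_comp f g x

lemma Diagram.IsCofibrant.isInvertedBy_weq {M : Diagram D} (hM : M.IsCofibrant) :
    (weq D).IsInvertedBy (hoFunctor M) := fun _ _ _ hf =>
  (isIso_iff_bijective _).2 (hM.bijective_map hf)

/-- The maps `p_f` and the constant paths are weak equivalences, so the functor inverts them and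
hence all ho-equivalences. -/
lemma Diagram.IsCofibrant.isInvertedBy_hoEquiv {M : Diagram D} (hM : M.IsCofibrant) :
    (hoEquiv D).IsInvertedBy (hoFunctor M) := by
  refine CEDiagram.isInvertedBy_hoEquiv D ⟨fun f => ?_, fun B => ?_⟩
  · exact hM.isInvertedBy_weq _ (weq_mappingPathFst f)
  · exact hM.isInvertedBy_weq _ fun i => (D.K i).weq_ι (B.obj i)

/-- The morphism `q_f ∘ p_f⁻¹` for the homotopy class of a ho-morphism. -/
noncomputable def HoClass.roof {A B : Diagram D} {E : Type*} [Category* E] {L : Diagram D ⥤ E}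
    (hL : HoHom.InvertsPaths L) : HoClass A B → (L.obj A ⟶ L.obj B) :=
  Quot.lift (fun f => f.roof hL) fun _ _ h => HoHom.roof_eq_of_homotopic hL h

lemma HoClass.roof_map {A B X : Diagram D} {E : Type*} [Category* E] {L : Diagram D ⥤ E}
    (hL : HoHom.InvertsPaths L) (g : B ⟶ X) (x : HoClass A B) :
    (HoClass.map g x).roof hL = x.roof hL ≫ L.map g := by
  induction x using Quot.ind with | _ x => exact HoHom.roof_comp hL x g

/-- Stated for general `W` because it serves both for `weq` and for `hoEquiv`. The universal element
is the identity, and the class of `s` on the mapping path maps to it under `p_f` and to `f` under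
`q_f`. -/
lemma HoClass.bijective_roof {W : MorphismProperty (Diagram D)} (hW : HoHom.InvertsPaths W.Q)
    {M : Diagram D} (hM : W.IsInvertedBy (hoFunctor M)) (B : Diagram D) :
    Function.Bijective (HoClass.roof (A := M) (B := B) hW) := by
  refine bijective_of_localization hM (HoHom.ofHom (𝟙 M)).cls (fun B => HoClass.roof hW)
    (fun f x => HoClass.roof_map hW f x) ?_ (fun B x => ?_) B
  · exact (HoHom.roof_ofHom hW (𝟙 M)).trans (W.Q.map_id M)
  · induction x using Quot.ind with
    | _ f =>
      exact ⟨f.mappingPath, f.mappingPathFst, f.mappingPathSnd, f.toMappingPath.cls, hW.fst f,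
        congrArg HoHom.cls f.toMappingPath_comp_fst, congrArg HoHom.cls f.toMappingPath_comp_snd⟩

/-- Morphisms out of `M` in the localization at `hoEquiv` are the classes `[M, -]^h`, on which weak
equivalences act bijectively. -/
lemma Diagram.IsCofibrant.isCECofibrant {M : Diagram D} (hM : M.IsCofibrant) :
    IsCECofibrant (hoEquiv D) (weq D) M := by
  intro A B f hf
  have hA := HoClass.bijective_roof (invertsPaths_hoEquiv D) hM.isInvertedBy_hoEquiv A
  have hB := HoClass.bijective_roof (invertsPaths_hoEquiv D) hM.isInvertedBy_hoEquiv B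
  refine (Function.Bijective.of_comp_iff _ hA).1 ?_
  convert hB.comp (hM.bijective_map hf)
  funext x
  exact (HoClass.roof_map (invertsPaths_hoEquiv D) f x).symm

/-! ### Cofibrant models -/

/-- Lifting the comparison morphisms of `X` through the vertex models commutes only up to homotopy,
which is exactly the datum of a ho-morphism; any choice of lifts is a diagram. -/
lemma exists_cofibrant_model
    (hcof : ∀ {i j : I} (a : i ⟶ j) (X : D.F.obj i),
      (D.K i).Cofibrant X → (D.K j).Cofibrant ((D.push a).obj X))
    (henough : ∀ i : I, (D.K i).EnoughCofibrant) (X : Diagram D) :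
    ∃ (M : Diagram D) (f : HoHom M X), cof D M ∧ ∀ i, (D.K i).weq (f.app i) := by
  choose M f hM hf using fun i => henough i (X.obj i)
  have h (i j : I) (a : i ⟶ j) (ha : NonIdentity a) :=
    (hcof a _ (hM i)).exists_lift_up_to_homotopy (hf j) ((D.push a).map (f i) ≫ X.φ a ha)
  choose φ γ h₀ h₁ using h
  exact ⟨⟨M, fun {i j} a ha => φ i j a ha⟩, HoHom.ofPr f (fun {i j} a ha => γ i j a ha)
    (fun {i j} a ha => h₀ i j a ha) (fun {i j} a ha => h₁ i j a ha), hM, hf⟩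

lemma isIso_roof_weq {A B : Diagram D} (f : HoHom A B) (hf : ∀ i, (D.K i).weq (f.app i)) :
    IsIso (f.roof (invertsPaths_weq D)) := by
  have := (invertsPaths_weq D).fst f
  have := (weq D).Q_inverts _ (weq_mappingPathSnd f hf)
  rw [HoHom.roof]
  infer_instance

lemma isLeftModel_of_weq {M X : Diagram D} (f : HoHom M X) (hf : ∀ i, (D.K i).weq (f.app i)) :
    IsLeftModel (isStrongWeak D) M X := by
  have key {A B : Diagram D} (g : A ⟶ B) (hg : weq D g) :
      IsIso ((Localization.Construction.lift (weq D).Q (isStrongWeak D).strong_le).map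
        ((hoEquiv D).Q.map g)) := by
    have := (weq D).Q_inverts g hg
    rw [← lift_map_Q (weq D).Q (isStrongWeak D).strong_le] at this
    exact this
  refine ⟨f.roof (invertsPaths_hoEquiv D), ?_⟩
  have := (invertsPaths_hoEquiv D).fst f
  have := key _ (weq_mappingPathFst f)
  have := key _ (weq_mappingPathSnd f hf)
  rw [HoHom.roof, Functor.map_comp, Functor.map_inv]
  infer_instance

/-! ### The category of homotopy classes of ho-morphisms -/

section HoCategory

variable (hcof : ∀ {i j : I} (a : i ⟶ j) (X : D.F.obj i),
      (D.K i).Cofibrant X → (D.K j).Cofibrant ((D.push a).obj X))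
include hcof

lemma isCofibrant_of_cof {M : Diagram D} (hM : cof D M) : M.IsCofibrant :=
  ⟨hM, fun {i _} a => hcof a _ (hM i)⟩

/-- The homotopy classes of ho-morphisms from a cofibrant diagram are the morphisms of the
homotopy category. -/
noncomputable def roofEquiv {A : Diagram D} (hA : cof D A) (B : Diagram D) :
    HoClass A B ≃ ((weq D).Q.obj A ⟶ (weq D).Q.obj B) :=
  Equiv.ofBijective _ (HoClass.bijective_roof (invertsPaths_weq D)
    (isCofibrant_of_cof hcof hA).isInvertedBy_weq B)

lemma roofEquiv_cls {A : Diagram D} (hA : cof D A) {B : Diagram D} (f : HoHom A B) :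
    roofEquiv hcof hA B f.cls = f.roof (invertsPaths_weq D) := rfl

lemma roofEquiv_id {A : Diagram D} (hA : cof D A) :
    roofEquiv hcof hA A (HoHom.ofHom (𝟙 A)).cls = 𝟙 _ := by
  rw [roofEquiv_cls, HoHom.roof_ofHom, (weq D).Q.map_id]

/-- The category of cofibrant diagrams and homotopy classes of ho-morphisms. -/
noncomputable def hoCategory : HoCategory D where
  -- The composition is transported from the homotopy category, so the category axioms are inherited
  -- and independence of representatives needs no proof; the geometric content is in `comp_cls`.
  comp {A B X} f g := (roofEquiv hcof A.property X.obj).symm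
    (roofEquiv hcof A.property B.obj f ≫ roofEquiv hcof B.property X.obj g)
  exists_composite {A _ _} f g :=
    HoHom.exists_isComposite (isCofibrant_of_cof hcof A.property).push f g
  comp_cls {A B X} f g k h := by
    rw [Equiv.symm_apply_eq, roofEquiv_cls, roofEquiv_cls, roofEquiv_cls]
    exact h.roof_eq (isCofibrant_of_cof hcof A.property).push (invertsPaths_weq D)
  id_comp f := by rw [roofEquiv_id, Category.id_comp, Equiv.symm_apply_apply]
  comp_id f := by rw [roofEquiv_id, Category.comp_id, Equiv.symm_apply_apply]
  assoc f g h := by simp only [Equiv.apply_symm_apply, Category.assoc]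

/-- The functor from the category of homotopy classes to the homotopy category. -/
noncomputable def hoCategoryFunctor : (hoCategory hcof).Ob ⥤ (weq D).Localization where
  obj A := (weq D).Q.obj A.diag
  map {A B} f := roofEquiv hcof A.isCof B.diag f
  map_id A := roofEquiv_id hcof A.isCof
  map_comp {A _ X} _ _ := (roofEquiv hcof A.isCof X.diag).apply_symm_apply _

lemma isEquivalence_hoCategoryFunctor (henough : ∀ i : I, (D.K i).EnoughCofibrant) :
    (hoCategoryFunctor hcof).IsEquivalence where
  faithful := ⟨fun {A B} _ _ h => (roofEquiv hcof A.isCof B.diag).injective h⟩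
  full := ⟨fun {A B} f => (roofEquiv hcof A.isCof B.diag).surjective f⟩
  essSurj := ⟨fun Y => by
    obtain ⟨M, f, hM, hf⟩ := exists_cofibrant_model hcof henough
      ((Localization.Construction.objEquiv (weq D)).symm Y)
    have := isIso_roof_weq f hf
    let e := asIso (f.roof (invertsPaths_weq D))
    exact ⟨⟨M, hM⟩, ⟨e ≪≫ eqToIso ((Localization.Construction.objEquiv (weq D)).apply_symm_apply Y)⟩⟩⟩

end HoCategory

end CEDiagram

theorem mainTheorem5 {I : Type w} [SmallCategory I] [FinCategory I]
    (D : CEDiagram.DiagramData.{w, v, u} I)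
    (hcof : ∀ {i j : I} (a : i ⟶ j) (X : D.F.obj i),
      (D.K i).Cofibrant X → (D.K j).Cofibrant ((D.push a).obj X))
    (henough : ∀ i : I, (D.K i).EnoughCofibrant) :
    CEDiagram.IsLeftCartanEilenberg (CEDiagram.hoEquiv D) (CEDiagram.Diagram.weq D) ∧
    CEDiagram.IsSubcategoryOfCofibrantModels (CEDiagram.hoEquiv D) (CEDiagram.Diagram.weq D)
      (CEDiagram.Diagram.cof D) ∧
    ∃ (H : CEDiagram.HoCategory D) (E : H.Ob ⥤ (CEDiagram.Diagram.weq D).Localization)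
      (e : ∀ A : H.Ob, E.obj A ≅ (CEDiagram.Diagram.weq D).Q.obj A.diag),
      E.IsEquivalence ∧
      (∀ {A B : H.Ob} (f : A.diag ⟶ B.diag),
        E.map (H.homCls (CEDiagram.HoHom.ofHom f)) ≫ (e B).hom =
          (e A).hom ≫ (CEDiagram.Diagram.weq D).Q.map f) ∧
      (∀ {A B : H.Ob} (f : CEDiagram.HoHom A.diag B.diag),
        (CEDiagram.Diagram.weq D).Q.map f.mappingPathFst ≫ (e A).inv ≫ E.map (H.homCls f) ≫
          (e B).hom = (CEDiagram.Diagram.weq D).Q.map f.mappingPathSnd) := by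

  have hmodel (X : CEDiagram.Diagram D) : ∃ M, CEDiagram.Diagram.cof D M ∧
      CEDiagram.IsLeftModel (CEDiagram.isStrongWeak D) M X := by
    obtain ⟨M, f, hM, hf⟩ := CEDiagram.exists_cofibrant_model hcof henough X
    exact ⟨M, hM, CEDiagram.isLeftModel_of_weq f hf⟩
  have hCE (M : CEDiagram.Diagram D) (hM : CEDiagram.Diagram.cof D M) :=
    (CEDiagram.isCofibrant_of_cof hcof hM).isCECofibrant
  refine ⟨⟨CEDiagram.isStrongWeak D, fun X => ?_⟩, ⟨CEDiagram.isStrongWeak D, hCE, hmodel⟩,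
    CEDiagram.hoCategory hcof, CEDiagram.hoCategoryFunctor hcof, fun A => Iso.refl _,
    CEDiagram.isEquivalence_hoCategoryFunctor hcof henough, fun {A B} f => ?_, fun {A B} f => ?_⟩
  · obtain ⟨M, hM, h⟩ := hmodel X
    exact ⟨M, hCE M hM, h⟩
  · rw [Iso.refl_hom, Iso.refl_hom]
    exact (Category.comp_id _).trans
      ((CEDiagram.HoHom.roof_ofHom (CEDiagram.invertsPaths_weq D) f).trans (Category.id_comp _).symm)
  · rw [Iso.refl_hom, Iso.refl_inv]
    refine Eq.trans ?_ (CEDiagram.HoHom.map_fst_roof (CEDiagram.invertsPaths_weq D) f)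
    exact congrArg _ ((Category.id_comp _).trans (Category.comp_id _))
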